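/- Let $1<\alpha\le 2$. Let $A_\alpha$ be the set of complex sequences $b=\{b_k\}_{k\in\mathbb Z}$ with $$\sup_{n\ge 1}\ \max_{|z|=1}\ \frac{(\log n)^{\alpha}}{n^{\alpha-1}}\Bigl|\sum_{k=-n}^{n} b_k z^k\Bigr|<\infty .$$ Let $\mathcal W$ be the set of finite complex linear combinations of the sequences $\{\lambda^k\}_{k\in\mathbb Z}$ with $\lambda\in\mathbb C$, $|\lambda|=1$, and let $AB_\alpha$ be the set of bounded complex sequences $a=\{a_k\}_{k\in\mathbb Z}$ such that $a-w\in A_\alpha$ for some $w\in\mathcal W$. Corollary 2.4. If $a\in AB_\alpha$, then $a$ is universally good for the ergodic Hilbert transform in $L_2$; that is, for every probability space $(X,\Sigma,\mu)$, every invertible (bimeasurable) measure preserving transformation $T:X\to X$ and every complex-valued $f\in L_2(X,\mu)$, the limit $$\lim_{n\to\infty}\ \sum_{0<|k|\le n}\frac{a_k\, f(T^k x)}{k}$$ exists in $\mathbb C$ for $\mu$-almost every $x\in X$. -/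

import Mathlib

open Filter Topology MeasureTheory

universe u

noncomputable section

namespace ErgodicHilbert

/-- The `n`-th symmetric partial sum `∑_{0 < |k| ≤ n} a_k f(T^k x) / k` of the ergodic Hilbert
transform of `f` modulated by `a`. Here `T^k`, `k ∈ ℤ`, is a power in the permutation group
of `X`. -/
def modulatedSum {X : Type*} (a : ℤ → ℂ) (T : Equiv.Perm X) (f : X → ℂ) (n : ℕ) (x : X) : ℂ :=
  ∑ k ∈ (Finset.Icc (-(n : ℤ)) (n : ℤ)).erase 0, a k * f ((T ^ k) x) / (k : ℂ)

/-- `a` is good for the ergodic Hilbert transform in `L_p` of the system `(X, μ, T)`: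
for every `f` in `L_p`, the modulated ergodic Hilbert transform exists almost everywhere. -/
def IsGood {X : Type*} [MeasurableSpace X] (a : ℤ → ℂ) (p : ENNReal) (μ : Measure X)
    (T : X ≃ᵐ X) : Prop :=
  ∀ f : X → ℂ, MemLp f p μ →
    ∀ᵐ x ∂μ, ∃ l : ℂ, Tendsto (fun n : ℕ => modulatedSum a T.toEquiv f n x) atTop (𝓝 l)

/-- `a` is universally good for the ergodic Hilbert transform in `L_p`: it is good for every
invertible measure preserving transformation of every probability space. -/
def IsUniversallyGood (a : ℤ → ℂ) (p : ENNReal) : Prop :=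
  ∀ (X : Type u) [MeasurableSpace X] (μ : Measure X) [IsProbabilityMeasure μ] (T : X ≃ᵐ X),
    MeasurePreserving T μ μ → IsGood a p μ T

/-- The class `A_α`: the supremum over `n ≥ 1` and `|z| = 1` of
`(log n)^α / n^(α - 1) * |∑_{|k| ≤ n} a_k z^k|` is finite. -/
def ClassA (α : ℝ) : Set (ℤ → ℂ) :=
  {a | ∃ C : ℝ, ∀ n : ℕ, 1 ≤ n → ∀ z : ℂ, ‖z‖ = 1 →
    Real.log n ^ α / (n : ℝ) ^ (α - 1) *
      ‖∑ k ∈ Finset.Icc (-(n : ℤ)) (n : ℤ), a k * z ^ k‖ ≤ C}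

/-- The class `W`: finite linear combinations of the sequences `(ξ^k)_{k ∈ ℤ}`, `|ξ| = 1`. -/
def ClassW : Submodule ℂ (ℤ → ℂ) :=
  Submodule.span ℂ {w | ∃ ξ : ℂ, ‖ξ‖ = 1 ∧ w = fun k : ℤ => ξ ^ k}

/-- The class `AB_α`: bounded sequences that differ from some element of `W` by an element
of `A_α`. -/
def ClassAB (α : ℝ) : Set (ℤ → ℂ) :=
  {a | Memℓp a ⊤ ∧ ∃ w ∈ ClassW, a - w ∈ ClassA α}

end ErgodicHilbert

end

/-!
A sequence `a` in `ClassAB α` is the sum of a bounded sequence `b` in `ClassA α` and of a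
trigonometric polynomial `w`, and the modulated ergodic Hilbert transforms of the two are treated
separately. In both cases estimates in `L²` come from the functional calculus of the Koopman
operator, possibly multiplied by a unimodular constant: a trigonometric polynomial in a unitary
operator is bounded by its supremum on the unit circle (`norm_cfc_unitary_le`), and a square
function by the supremum of the square function of the symbols (`sum_norm_cfc_unitary_sq_le`).

For `b`, it suffices to treat `α = 2`, so that `∑_{|k| ≤ n} b_k z^k` is of size `n / (log n) ^ 2`.
Summation by parts bounds the sums of `b_k z^k / |k|` over `n < |k| ≤ m`, where `m ≤ 2 n`, by a
multiple of `1 / (log n) ^ 2`. Replacing `|k|` by `k` costs only a constant: on frequencies in one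
dyadic block the projection onto positive frequencies is a Fourier multiplier whose kernel can be
chosen as a product of two geometric sums, bounded in `L¹` by Cauchy–Schwarz
(`norm_sum_pos_freq_le`). Hence the truncated transforms vary by `O(1 / j ^ 2)` in operator norm
inside the `j`-th dyadic interval. Summing over `j`, the truncations at `2 ^ j` are at distance
`O(1 / j)` from their limit, and as `∑ 1 / j ^ 2 < ∞` they converge almost everywhere. Inside the
`j`-th dyadic interval one uses `j ^ 2` grid points: their contribution to the squared oscillation
is `j ^ 2 * O(1 / j ^ 4)`, and the stretches between consecutive grid points, of length
`2 ^ j / j ^ 2`, contribute `O(1 / j ^ 2)` because `b` is bounded. Both are summable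
(`ae_exists_tendsto_modulatedSum_of_dyadic`).

For a character `k ↦ ξ ^ k`, the transform vanishes on functions invariant under the twisted Koopman
operator `V` and converges on coboundaries `V h - h`; together these span a dense subspace. The
convergence passes to all of `L²` by a maximal inequality of weak type `(2, 2)`
(`measure_exists_lt_norm_modulatedSum_le`). That inequality follows Cotlar: with `h` the transform
truncated at a very large scale and `A` the ergodic average of length `2 ^ j`, the transform
truncated at `2 ^ j` equals `h - A h` up to errors which form a bounded square function
(`sum_norm_errorSymbol_le`), the averages are controlled by the maximal ergodic inequality
(`mul_measure_exists_lt_sum_le`), and truncations between consecutive powers of two differ by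
averages of `|f|`.
-/

noncomputable section

namespace ErgodicHilbert

/-! ### Trigonometric sums on the unit circle -/

/-- Summation by parts: a bounded sequence `D` paired with nonincreasing weights. -/
theorem norm_sum_mul_sub_le (c : ℕ → ℝ) (hc : Antitone c) (hc0 : ∀ k, 0 ≤ c k)
    (D : ℕ → ℂ) (E : ℝ) {n m : ℕ} (hnm : n ≤ m)
    (hD : ∀ k, n ≤ k → k ≤ m → ‖D k‖ ≤ E) :
    ‖∑ k ∈ Finset.Ico n m, (c k : ℂ) * (D (k + 1) - D k)‖ ≤ 2 * E * c n := by
  have key : ∀ l, n ≤ l → l ≤ m →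
      ‖∑ k ∈ Finset.Ico n l, (c k : ℂ) * (D (k + 1) - D k) - c l * D l‖
        ≤ E * (2 * c n - c l) := by
    intro l hl
    induction l, hl using Nat.le_induction with
    | base =>
      intro h
      have := mul_le_mul_of_nonneg_left (hD n le_rfl h) (hc0 n)
      simp only [Finset.Ico_self, Finset.sum_empty, zero_sub, norm_neg, norm_mul,
        Complex.norm_real, Real.norm_eq_abs, abs_of_nonneg (hc0 n)]
      linarith
    | succ l hl ih =>
      intro h
      have h1 := ih (by omega)
      have h2 := hD (l + 1) (by omega) h
      have h3 : 0 ≤ c l - c (l + 1) := sub_nonneg.2 (hc (Nat.le_succ l))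
      have : ∑ k ∈ Finset.Ico n (l + 1), (c k : ℂ) * (D (k + 1) - D k) - c (l + 1) * D (l + 1)
          = (∑ k ∈ Finset.Ico n l, (c k : ℂ) * (D (k + 1) - D k) - c l * D l)
            + ((c l - c (l + 1) : ℝ) : ℂ) * D (l + 1) := by
        rw [Finset.sum_Ico_succ_top hl]
        push_cast
        ring
      rw [this]
      refine (norm_add_le _ _).trans ?_
      rw [norm_mul, Complex.norm_real, Real.norm_eq_abs, abs_of_nonneg h3]
      have := mul_le_mul_of_nonneg_left h2 h3
      linarith
  have h1 := key m hnm le_rfl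
  have h2 := mul_le_mul_of_nonneg_left (hD m hnm le_rfl) (hc0 m)
  calc _ = ‖(∑ k ∈ Finset.Ico n m, (c k : ℂ) * (D (k + 1) - D k) - c m * D m) + c m * D m‖ := by
        rw [sub_add_cancel]
    _ ≤ _ + ‖(c m : ℂ) * D m‖ := norm_add_le _ _
    _ ≤ _ := by
        rw [norm_mul, Complex.norm_real, Real.norm_eq_abs, abs_of_nonneg (hc0 m)]
        linarith

theorem sum_erase_zero_eq {M : Type*} [AddCommMonoid M] (φ : ℤ → M) (n : ℕ) :
    ∑ k ∈ (Finset.Icc (-(n : ℤ)) (n : ℤ)).erase 0, φ k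
      = ∑ k ∈ Finset.range n, (φ (k + 1) + φ (-(k + 1))) := by
  induction n with
  | zero => simp
  | succ n ih =>
    have : (Finset.Icc (-((n + 1 : ℕ) : ℤ)) ((n + 1 : ℕ) : ℤ)).erase 0
        = insert (n + 1 : ℤ) (insert (-(n + 1 : ℤ))
          ((Finset.Icc (-(n : ℤ)) (n : ℤ)).erase 0)) := by
      ext k
      simp only [Finset.mem_erase, Finset.mem_Icc, Finset.mem_insert]
      omega
    rw [this, Finset.sum_insert, Finset.sum_insert, ih, Finset.sum_range_succ]
    · rw [add_comm, add_assoc, add_comm (φ (-(n + 1)))]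
      grind
    · simp
    · simp only [Finset.mem_erase, Finset.mem_Icc, Finset.mem_insert]
      omega

theorem sum_Icc_eq {M : Type*} [AddCommMonoid M] (φ : ℤ → M) (n : ℕ) :
    ∑ k ∈ Finset.Icc (-(n : ℤ)) (n : ℤ), φ k
      = φ 0 + ∑ k ∈ Finset.range n, (φ (k + 1) + φ (-(k + 1))) := by
  rw [← sum_erase_zero_eq, Finset.add_sum_erase _ _ (by simp)]

/-- Averaging a trigonometric polynomial over the `L`-th roots of unity isolates its constant
coefficient, as long as all frequencies are below `L` in absolute value. -/
theorem sum_zpow_rootsOfUnity {L : ℕ} {ζ : ℂ} (hζ : IsPrimitiveRoot ζ L) (k : ℤ)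
    (hk : |k| < L) :
    ∑ l ∈ Finset.range L, (ζ ^ l) ^ k = if k = 0 then (L : ℂ) else 0 := by
  split_ifs with h
  · simp [h]
  · have h0 : ζ ≠ 0 := hζ.ne_zero (by rintro rfl; simp at hk; have := abs_nonneg k; omega)
    have h1 : ζ ^ k ≠ 1 := fun h1 =>
      h (Int.eq_zero_of_abs_lt_dvd ((hζ.zpow_eq_one_iff_dvd k).1 h1) hk)
    have h2 : ∀ l : ℕ, (ζ ^ l) ^ k = (ζ ^ k) ^ l := fun l => by
      rw [← zpow_natCast, ← zpow_natCast, ← zpow_mul, ← zpow_mul, mul_comm]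
    simp_rw [h2]
    rw [geom_sum_eq h1, ← h2, hζ.pow_eq_one, one_zpow, sub_self, zero_div]

theorem norm_eq_one_of_isPrimitiveRoot {L : ℕ} (hL : L ≠ 0) {ζ : ℂ} (hζ : IsPrimitiveRoot ζ L)
    (l : ℕ) : ‖ζ ^ l‖ = 1 := by
  rw [norm_pow, hζ.norm'_eq_one hL, one_pow]

theorem zpow_mul_inv_pow {z w : ℂ} (hw : w ≠ 0) (q : ℤ) (a : ℕ) :
    w ^ q * (z * w⁻¹) ^ a = z ^ a * w ^ (q - a) := by
  rw [mul_pow, zpow_sub₀ hw, zpow_natCast, inv_pow]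
  field_simp

/-- Discrete Parseval identity for a geometric sum sampled at rotated roots of unity. -/
theorem sum_normSq_geom_sum {L : ℕ} {ζ : ℂ} (hζ : IsPrimitiveRoot ζ L) {N : ℕ} (hN : N ≤ L)
    (hL : L ≠ 0) {z : ℂ} (hz : ‖z‖ = 1) :
    ∑ l ∈ Finset.range L, ‖∑ a ∈ Finset.range N, (z * (ζ ^ l)⁻¹) ^ a‖ ^ 2 = N * L := by
  have hz0 : z ≠ 0 := by rintro rfl; simp at hz
  have expand : ∀ l, ((‖∑ a ∈ Finset.range N, (z * (ζ ^ l)⁻¹) ^ a‖ ^ 2 : ℝ) : ℂ)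
      = ∑ a ∈ Finset.range N, ∑ b ∈ Finset.range N,
        z ^ ((a : ℤ) - b) * (ζ ^ l) ^ ((b : ℤ) - a) := by
    intro l
    have h1 : ‖z * (ζ ^ l)⁻¹‖ = 1 := by
      rw [norm_mul, norm_inv, norm_eq_one_of_isPrimitiveRoot hL hζ, hz]; simp
    have h0 : ζ ^ l ≠ 0 := pow_ne_zero _ (hζ.ne_zero hL)
    rw [Complex.ofReal_pow, ← Complex.mul_conj', map_sum, Finset.sum_mul_sum]
    refine Finset.sum_congr rfl fun a _ => Finset.sum_congr rfl fun b _ => ?_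
    rw [map_pow, ← Complex.inv_eq_conj h1, zpow_sub₀ hz0, zpow_sub₀ h0]
    simp only [zpow_natCast]
    rw [mul_inv, inv_inv, mul_pow, mul_pow, inv_pow, inv_pow]
    field_simp
  have : ((∑ l ∈ Finset.range L, ‖∑ a ∈ Finset.range N, (z * (ζ ^ l)⁻¹) ^ a‖ ^ 2 : ℝ) : ℂ)
      = ((N * L : ℝ) : ℂ) := by
    rw [Complex.ofReal_sum]
    simp_rw [expand]
    rw [Finset.sum_comm]
    have : ∀ a ∈ Finset.range N, ∑ l ∈ Finset.range L, ∑ b ∈ Finset.range N,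
        z ^ ((a : ℤ) - b) * (ζ ^ l) ^ ((b : ℤ) - a) = L := by
      intro a ha
      rw [Finset.sum_comm]
      have h2 : ∀ b ∈ Finset.range N, ∑ l ∈ Finset.range L,
          z ^ ((a : ℤ) - b) * (ζ ^ l) ^ ((b : ℤ) - a) = if b = a then (L : ℂ) else 0 := by
        intro b hb
        rw [Finset.mem_range] at ha hb
        rw [← Finset.mul_sum, sum_zpow_rootsOfUnity hζ _ (by rw [abs_lt]; omega)]
        by_cases h : b = a
        · simp [h]
        · rw [if_neg (by omega), if_neg h, mul_zero]
      rw [Finset.sum_congr rfl h2, Finset.sum_ite_eq', if_pos ha]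
    rw [Finset.sum_congr rfl this]
    simp
  exact_mod_cast this

/-- The product of two geometric sums of lengths `n + 1` and `2 n + 1` acts, as a Fourier
multiplier, as the constant `n + 1` on the frequencies `n < q ≤ 2 n` and as `0` on negative ones. -/
theorem sum_zpow_mul_geom_sum_mul_geom_sum {n : ℕ} {ζ : ℂ}
    (hζ : IsPrimitiveRoot ζ (8 * n + 8)) {z : ℂ} {q : ℤ} (hq : |q| ≤ 2 * n)
    (hq' : n < q ∨ q < 0) :
    ∑ l ∈ Finset.range (8 * n + 8), (ζ ^ l) ^ q *
      ((∑ a ∈ Finset.range (n + 1), (z * (ζ ^ l)⁻¹) ^ a) *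
        ∑ b ∈ Finset.range (2 * n + 1), (z * (ζ ^ l)⁻¹) ^ b)
      = if 0 < q then ((8 * n + 8 : ℕ) : ℂ) * (n + 1) * z ^ q else 0 := by
  rw [abs_le] at hq
  have h0 : ζ ≠ 0 := hζ.ne_zero (by omega)
  have expand : ∀ l, (ζ ^ l) ^ q *
      ((∑ a ∈ Finset.range (n + 1), (z * (ζ ^ l)⁻¹) ^ a) *
        ∑ b ∈ Finset.range (2 * n + 1), (z * (ζ ^ l)⁻¹) ^ b)
      = ∑ a ∈ Finset.range (n + 1), ∑ b ∈ Finset.range (2 * n + 1),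
        z ^ (a + b) * (ζ ^ l) ^ (q - (a + b : ℕ)) := by
    intro l
    rw [Finset.sum_mul_sum, Finset.mul_sum]
    refine Finset.sum_congr rfl fun a _ => ?_
    rw [Finset.mul_sum]
    refine Finset.sum_congr rfl fun b _ => ?_
    rw [← pow_add, zpow_mul_inv_pow (pow_ne_zero _ h0)]
  simp_rw [expand]
  rw [Finset.sum_comm]
  have key : ∀ a ∈ Finset.range (n + 1), ∑ l ∈ Finset.range (8 * n + 8),
      ∑ b ∈ Finset.range (2 * n + 1), z ^ (a + b) * (ζ ^ l) ^ (q - (a + b : ℕ))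
      = if 0 < q then ((8 * n + 8 : ℕ) : ℂ) * z ^ q else 0 := by
    intro a ha
    rw [Finset.mem_range] at ha
    rw [Finset.sum_comm]
    have h2 : ∀ b ∈ Finset.range (2 * n + 1), ∑ l ∈ Finset.range (8 * n + 8),
        z ^ (a + b) * (ζ ^ l) ^ (q - (a + b : ℕ))
        = if b = (q - a).toNat then (if 0 < q then ((8 * n + 8 : ℕ) : ℂ) * z ^ q else 0)
          else 0 := by
      intro b hb
      rw [Finset.mem_range] at hb
      rw [← Finset.mul_sum, sum_zpow_rootsOfUnity hζ _ (by rw [abs_lt]; push_cast; omega)]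
      by_cases hqp : 0 < q
      · by_cases h : b = (q - a).toNat
        · rw [if_pos (by omega), if_pos h, if_pos hqp]
          have : q = ((a + b : ℕ) : ℤ) := by omega
          rw [this, zpow_natCast, mul_comm]
        · rw [if_neg (by omega), if_neg h, mul_zero]
      · rw [if_neg (by omega), if_neg hqp, ite_self, mul_zero]
    rw [Finset.sum_congr rfl h2, Finset.sum_ite_eq']
    by_cases hqp : 0 < q
    · rw [if_pos (by rw [Finset.mem_range]; omega)]
    · rw [if_neg hqp, ite_self]
  rw [Finset.sum_congr rfl key]
  split_ifs
  · simp; ring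
  · simp

/-- The Riesz projection onto positive frequencies is bounded in the uniform norm on trigonometric
polynomials with frequencies in a dyadic block `n < |k| ≤ 2 n`, with a bound independent of `n`. -/
theorem norm_sum_pos_freq_le {n m : ℕ} (hm : m ≤ 2 * n) (u v : ℕ → ℂ) (E : ℝ)
    (hE : ∀ z : ℂ, ‖z‖ = 1 →
      ‖∑ k ∈ Finset.Ico n m, (u k * z ^ ((k : ℤ) + 1) + v k * z ^ (-((k : ℤ) + 1)))‖ ≤ E)
    (z : ℂ) (hz : ‖z‖ = 1) :
    ‖∑ k ∈ Finset.Ico n m, u k * z ^ ((k : ℤ) + 1)‖ ≤ 2 * E := by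
  obtain ⟨ζ, hζ⟩ : ∃ ζ : ℂ, IsPrimitiveRoot ζ (8 * n + 8) :=
    ⟨_, Complex.isPrimitiveRoot_exp _ (by omega)⟩
  set G : ℂ → ℂ := fun z =>
    ∑ k ∈ Finset.Ico n m, (u k * z ^ ((k : ℤ) + 1) + v k * z ^ (-((k : ℤ) + 1))) with hG
  set A : ℕ → ℂ := fun l => ∑ a ∈ Finset.range (n + 1), (z * (ζ ^ l)⁻¹) ^ a with hA
  set B : ℕ → ℂ := fun l => ∑ a ∈ Finset.range (2 * n + 1), (z * (ζ ^ l)⁻¹) ^ a with hB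
  have hE0 : 0 ≤ E := (norm_nonneg _).trans (hE 1 (by simp))
  have key : ∑ l ∈ Finset.range (8 * n + 8), G (ζ ^ l) * (A l * B l)
      = ((8 * n + 8 : ℕ) : ℂ) * (n + 1) * ∑ k ∈ Finset.Ico n m, u k * z ^ ((k : ℤ) + 1) := by
    simp only [hG, Finset.sum_mul]
    rw [Finset.sum_comm, Finset.mul_sum]
    refine Finset.sum_congr rfl fun k hk => ?_
    rw [Finset.mem_Ico] at hk
    have h1 := sum_zpow_mul_geom_sum_mul_geom_sum hζ (z := z) (q := (k : ℤ) + 1)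
      (by rw [abs_le]; omega) (by omega)
    have h2 := sum_zpow_mul_geom_sum_mul_geom_sum hζ (z := z) (q := -((k : ℤ) + 1))
      (by rw [abs_le]; omega) (by omega)
    rw [if_pos (by omega)] at h1
    rw [if_neg (by omega)] at h2
    simp only [add_mul, mul_assoc]
    rw [Finset.sum_add_distrib, ← Finset.mul_sum, ← Finset.mul_sum, h1, h2]
    ring
  have bound : ‖∑ l ∈ Finset.range (8 * n + 8), G (ζ ^ l) * (A l * B l)‖
      ≤ E * ((3 * n + 2) * (8 * n + 8) / 2) := by
    have hA2 := sum_normSq_geom_sum hζ (N := n + 1) (by omega) (by omega) hz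
    have hB2 := sum_normSq_geom_sum hζ (N := 2 * n + 1) (by omega) (by omega) hz
    calc _ ≤ ∑ l ∈ Finset.range (8 * n + 8), ‖G (ζ ^ l) * (A l * B l)‖ := norm_sum_le _ _
      _ ≤ ∑ l ∈ Finset.range (8 * n + 8), E * ((‖A l‖ ^ 2 + ‖B l‖ ^ 2) / 2) := by
          refine Finset.sum_le_sum fun l _ => ?_
          rw [norm_mul, norm_mul]
          have h1 : ‖G (ζ ^ l)‖ ≤ E :=
            hE _ (norm_eq_one_of_isPrimitiveRoot (by omega) hζ l)
          have h2 : ‖A l‖ * ‖B l‖ ≤ (‖A l‖ ^ 2 + ‖B l‖ ^ 2) / 2 := by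
            nlinarith [sq_nonneg (‖A l‖ - ‖B l‖)]
          exact mul_le_mul h1 h2 (by positivity) hE0
      _ = E * ((∑ l ∈ Finset.range (8 * n + 8), ‖A l‖ ^ 2
            + ∑ l ∈ Finset.range (8 * n + 8), ‖B l‖ ^ 2) / 2) := by
          rw [← Finset.mul_sum, ← Finset.sum_div, Finset.sum_add_distrib]
      _ = _ := by
          rw [hA2, hB2]
          push_cast
          ring
  rw [key, norm_mul] at bound
  have hn : ‖((8 * n + 8 : ℕ) : ℂ) * (n + 1)‖ = (8 * n + 8) * (n + 1) := by
    rw [norm_mul, Complex.norm_natCast]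
    have : (n + 1 : ℂ) = ((n + 1 : ℕ) : ℂ) := by push_cast; rfl
    rw [this, Complex.norm_natCast]
    push_cast; rfl
  rw [hn] at bound
  have hpos : (0 : ℝ) < (8 * n + 8) * (n + 1) := by positivity
  refine le_of_mul_le_mul_left (bound.trans ?_) hpos
  have : (0 : ℝ) ≤ n := n.cast_nonneg
  have h3 : (3 * n + 2) * (8 * n + 8) / 2 ≤ ((8 * n + 8) * (n + 1) * 2 : ℝ) := by nlinarith
  calc _ ≤ E * ((8 * n + 8) * (n + 1) * 2 : ℝ) := mul_le_mul_of_nonneg_left h3 hE0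
    _ = _ := by ring

/-! ### Symbols of the truncated Hilbert transforms -/

/-- The symbol `∑_{0 < |k| ≤ n} c_k z^k / k` of the truncated Hilbert transform modulated by `c`. -/
def hilbertSymbol (c : ℤ → ℂ) (n : ℕ) (z : ℂ) : ℂ :=
  ∑ k ∈ (Finset.Icc (-(n : ℤ)) (n : ℤ)).erase 0, c k * z ^ k / (k : ℂ)

theorem hilbertSymbol_sub (c : ℤ → ℂ) {n m : ℕ} (hnm : n ≤ m) (z : ℂ) :
    hilbertSymbol c m z - hilbertSymbol c n z = ∑ k ∈ Finset.Ico n m,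
      (c (k + 1) * z ^ ((k : ℤ) + 1) / (k + 1)
        - c (-(k + 1)) * z ^ (-((k : ℤ) + 1)) / (k + 1)) := by
  unfold hilbertSymbol
  rw [sum_erase_zero_eq, sum_erase_zero_eq, Finset.sum_Ico_eq_sub _ hnm]
  congr 1 <;>
  · refine Finset.sum_congr rfl fun k _ => ?_
    push_cast
    rw [div_neg, sub_eq_add_neg]

theorem hilbertSymbol_zero (c : ℤ → ℂ) (z : ℂ) : hilbertSymbol c 0 z = 0 := by
  simp [hilbertSymbol]

theorem antitone_one_div_succ : Antitone fun k : ℕ => (1 / ((k : ℝ) + 1)) := fun a b h => by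
  have : (a : ℝ) ≤ b := by exact_mod_cast h
  dsimp only
  gcongr

/-- Symmetric partial sums `D_k` of size at most `E` for `n ≤ k ≤ 2 n` control the dyadic block of
the Hilbert symbol: Abel summation handles the weight `1 / |k|` and the bounded Riesz projection
inserts the sign of `k`. -/
theorem norm_hilbertSymbol_sub_le_of_partialSums (b : ℤ → ℂ) {n m : ℕ} (hnm : n ≤ m)
    (hm : m ≤ 2 * n) (E : ℝ)
    (hD : ∀ k : ℕ, n ≤ k → k ≤ m → ∀ z : ℂ, ‖z‖ = 1 →
      ‖∑ i ∈ Finset.Icc (-(k : ℤ)) (k : ℤ), b i * z ^ i‖ ≤ E)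
    (z : ℂ) (hz : ‖z‖ = 1) :
    ‖hilbertSymbol b m z - hilbertSymbol b n z‖ ≤ 10 * E / (n + 1) := by
  have hG : ∀ z : ℂ, ‖z‖ = 1 →
      ‖∑ k ∈ Finset.Ico n m, (b (k + 1) / (k + 1) * z ^ ((k : ℤ) + 1)
        + b (-(k + 1)) / (k + 1) * z ^ (-((k : ℤ) + 1)))‖ ≤ 2 * E * (1 / (n + 1)) := by
    intro z hz
    have := norm_sum_mul_sub_le (fun k : ℕ => 1 / ((k : ℝ) + 1)) antitone_one_div_succ
      (fun k => by positivity) (fun k => ∑ i ∈ Finset.Icc (-(k : ℤ)) (k : ℤ), b i * z ^ i) E hnm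
      (fun k h1 h2 => hD k h1 h2 z hz)
    refine le_of_eq_of_le ?_ this
    congr 1
    refine Finset.sum_congr rfl fun k _ => ?_
    rw [sum_Icc_eq, sum_Icc_eq, Finset.sum_range_succ]
    push_cast
    ring
  have hP := norm_sum_pos_freq_le hm _ _ _ hG z hz
  rw [hilbertSymbol_sub b hnm]
  have : ∑ k ∈ Finset.Ico n m,
      (b (k + 1) * z ^ ((k : ℤ) + 1) / (k + 1) - b (-(k + 1)) * z ^ (-((k : ℤ) + 1)) / (k + 1))
      = (2 : ℂ) * ∑ k ∈ Finset.Ico n m, b (k + 1) / (k + 1) * z ^ ((k : ℤ) + 1)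
        - ∑ k ∈ Finset.Ico n m, (b (k + 1) / (k + 1) * z ^ ((k : ℤ) + 1)
        + b (-(k + 1)) / (k + 1) * z ^ (-((k : ℤ) + 1))) := by
    rw [Finset.mul_sum, ← Finset.sum_sub_distrib]
    refine Finset.sum_congr rfl fun k _ => ?_
    ring
  rw [this]
  refine (norm_sub_le _ _).trans ?_
  rw [norm_mul, Complex.norm_ofNat]
  have := hG z hz
  calc _ ≤ 2 * (2 * (2 * E * (1 / (n + 1)))) + 2 * E * (1 / (n + 1)) := by gcongr
    _ = _ := by ring

theorem norm_pow_sub_one_le {z : ℂ} (hz : ‖z‖ = 1) (n : ℕ) :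
    ‖z ^ n - 1‖ ≤ n * ‖1 - z‖ := by
  rw [← mul_geom_sum, norm_mul, norm_sub_rev z 1, mul_comm]
  gcongr
  refine (norm_sum_le _ _).trans ?_
  simp [hz]

theorem norm_hilbertSymbol_one_le {z : ℂ} (hz : ‖z‖ = 1) (n : ℕ) :
    ‖hilbertSymbol 1 n z‖ ≤ 2 * n * ‖1 - z‖ := by
  have hz0 : z ≠ 0 := by rintro rfl; simp at hz
  have h := hilbertSymbol_sub 1 (Nat.zero_le n) z
  rw [hilbertSymbol_zero, sub_zero] at h
  rw [h]
  refine (norm_sum_le _ _).trans ?_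
  have : ∀ k ∈ Finset.Ico 0 n, ‖(1 : ℤ → ℂ) (k + 1) * z ^ ((k : ℤ) + 1) / (k + 1)
      - (1 : ℤ → ℂ) (-(k + 1)) * z ^ (-((k : ℤ) + 1)) / (k + 1)‖ ≤ 2 * ‖1 - z‖ := by
    intro k _
    have h1 : (1 : ℤ → ℂ) (k + 1) * z ^ ((k : ℤ) + 1) / (k + 1)
      - (1 : ℤ → ℂ) (-(k + 1)) * z ^ (-((k : ℤ) + 1)) / (k + 1)
      = z ^ (-((k : ℤ) + 1)) * ((z ^ (2 * (k + 1)) - 1) / ((k + 1 : ℕ) : ℂ)) := by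
      have : z ^ ((k : ℤ) + 1) = z ^ (-((k : ℤ) + 1)) * z ^ (2 * (k + 1)) := by
        rw [← zpow_natCast, ← zpow_add₀ hz0]
        congr 1
        push_cast
        ring
      rw [this]
      simp only [Pi.one_apply]
      push_cast
      ring
    rw [h1, norm_mul, norm_zpow, hz, one_zpow, one_mul, norm_div, Complex.norm_natCast]
    rw [div_le_iff₀ (by positivity)]
    refine (norm_pow_sub_one_le hz _).trans (le_of_eq ?_)
    push_cast
    ring
  refine (Finset.sum_le_sum this).trans (le_of_eq ?_)
  simp
  ring

/-- Away from `z = 1` the Hilbert symbols converge at the rate `1 / n`: multiplying by `1 - z` turns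
the block into two sums by parts. -/
theorem norm_hilbertSymbol_one_sub_mul_le {z : ℂ} (hz : ‖z‖ = 1) {n m : ℕ} (hnm : n ≤ m) :
    ‖hilbertSymbol 1 m z - hilbertSymbol 1 n z‖ * ‖1 - z‖ ≤ 4 / (n + 1) := by
  have hw : ‖z⁻¹‖ = 1 := by rw [norm_inv, hz, inv_one]
  have hz0 : z ≠ 0 := by rintro rfl; simp at hz
  have key : ∀ w : ℂ, ‖w‖ = 1 →
      ‖∑ k ∈ Finset.Ico n m, ((1 / ((k : ℝ) + 1) : ℝ) : ℂ) * (w ^ (k + 1 + 1) - w ^ (k + 1))‖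
        ≤ 2 / (n + 1) := by
    intro w hw
    refine (norm_sum_mul_sub_le _ antitone_one_div_succ (fun k => by positivity)
      (fun k => w ^ (k + 1)) 1 hnm (fun k _ _ => by rw [norm_pow, hw, one_pow])).trans
      (le_of_eq (by ring))
  have e : (hilbertSymbol 1 m z - hilbertSymbol 1 n z) * (1 - z)
      = -(∑ k ∈ Finset.Ico n m, ((1 / ((k : ℝ) + 1) : ℝ) : ℂ) * (z ^ (k + 1 + 1) - z ^ (k + 1)))
       - z * ∑ k ∈ Finset.Ico n m,
          ((1 / ((k : ℝ) + 1) : ℝ) : ℂ) * (z⁻¹ ^ (k + 1 + 1) - z⁻¹ ^ (k + 1)) := by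
    rw [hilbertSymbol_sub 1 hnm, Finset.sum_mul, Finset.mul_sum, ← Finset.sum_neg_distrib,
      ← Finset.sum_sub_distrib]
    refine Finset.sum_congr rfl fun k _ => ?_
    have h1 : z ^ (-((k : ℤ) + 1)) = z⁻¹ ^ (k + 1) := by
      rw [← inv_zpow']; exact_mod_cast zpow_natCast z⁻¹ (k + 1)
    have h2 : z ^ ((k : ℤ) + 1) = z ^ (k + 1) := by exact_mod_cast zpow_natCast z (k + 1)
    rw [h1, h2, pow_succ z⁻¹ (k + 1)]
    simp only [Pi.one_apply]
    push_cast
    field_simp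
    ring
  rw [← norm_mul, e]
  refine (norm_sub_le _ _).trans ?_
  rw [norm_neg, norm_mul, hz, one_mul]
  calc _ ≤ 2 / ((n : ℝ) + 1) + 2 / ((n : ℝ) + 1) := add_le_add (key z hz) (key _ hw)
    _ = _ := by ring

theorem norm_hilbertSymbol_one_le_six {z : ℂ} (hz : ‖z‖ = 1) (n : ℕ) :
    ‖hilbertSymbol 1 n z‖ ≤ 6 := by
  rcases (norm_nonneg (1 - z)).eq_or_lt with h0 | h0
  · have := norm_hilbertSymbol_one_le hz n
    rw [← h0] at this
    linarith
  -- The frequencies up to `1 / |1 - z|` contribute a bounded amount by the first estimate.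
  set N := ⌊1 / ‖1 - z‖⌋₊ with hN
  have hN1 : N * ‖1 - z‖ ≤ 1 := by
    rw [← le_div_iff₀ h0]; exact Nat.floor_le (by positivity)
  have hN2 : 1 < (N + 1) * ‖1 - z‖ := by
    rw [← div_lt_iff₀ h0]; exact Nat.lt_floor_add_one _
  rcases le_total n N with h | h
  · have h1 := norm_hilbertSymbol_one_le hz n
    have h2 : (n : ℝ) ≤ N := by exact_mod_cast h
    have := mul_le_mul_of_nonneg_right h2 h0.le
    linarith
  · have h1 := norm_hilbertSymbol_one_le hz N
    have h2 := norm_hilbertSymbol_one_sub_mul_le hz h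
    rw [le_div_iff₀ (by positivity)] at h2
    have h3 : ‖hilbertSymbol 1 n z - hilbertSymbol 1 N z‖ ≤ 4 := by
      have := norm_nonneg (hilbertSymbol 1 n z - hilbertSymbol 1 N z)
      nlinarith
    have h4 := norm_sub_norm_le (hilbertSymbol 1 n z) (hilbertSymbol 1 N z)
    linarith

/-- The symbol of the ergodic average of length `n`. -/
def averageSymbol (n : ℕ) (z : ℂ) : ℂ := (n : ℂ)⁻¹ * ∑ i ∈ Finset.range n, z ^ i

theorem norm_one_sub_averageSymbol_le {z : ℂ} (hz : ‖z‖ = 1) {n : ℕ} (hn : n ≠ 0) :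
    ‖1 - averageSymbol n z‖ ≤ n * ‖1 - z‖ := by
  have hn' : (n : ℂ) ≠ 0 := by exact_mod_cast hn
  have : 1 - averageSymbol n z = (n : ℂ)⁻¹ * ∑ i ∈ Finset.range n, (1 - z ^ i) := by
    rw [averageSymbol, Finset.sum_sub_distrib, mul_sub]
    simp [hn']
  rw [this, norm_mul, norm_inv, Complex.norm_natCast, inv_mul_le_iff₀ (by positivity)]
  refine (norm_sum_le _ _).trans ?_
  have : ∀ i ∈ Finset.range n, ‖1 - z ^ i‖ ≤ n * ‖1 - z‖ := fun i hi => by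
    rw [norm_sub_rev]
    refine (norm_pow_sub_one_le hz i).trans ?_
    gcongr
    exact (Finset.mem_range.1 hi).le
  refine (Finset.sum_le_sum this).trans (le_of_eq (by simp))

theorem norm_averageSymbol_mul_le {z : ℂ} (hz : ‖z‖ = 1) {n : ℕ} (hn : n ≠ 0) :
    ‖averageSymbol n z‖ * (n * ‖1 - z‖) ≤ 2 := by
  have hn' : (n : ℂ) ≠ 0 := by exact_mod_cast hn
  have hn'' : ‖(n : ℂ)‖ = n := Complex.norm_natCast n
  rw [← hn'', ← norm_mul, ← norm_mul, averageSymbol]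
  have : (n : ℂ)⁻¹ * (∑ i ∈ Finset.range n, z ^ i) * (n * (1 - z)) = 1 - z ^ n := by
    rw [← mul_neg_geom_sum z n]
    field_simp
  rw [this]
  refine (norm_sub_le _ _).trans ?_
  rw [norm_pow, hz]
  norm_num

/-- The symbol of the error made when the truncation at `n` is replaced by the truncation at `L`
minus its ergodic average of length `n`. -/
def errorSymbol (L n : ℕ) (z : ℂ) : ℂ :=
  hilbertSymbol 1 n z - hilbertSymbol 1 L z + averageSymbol n z * hilbertSymbol 1 L z

theorem norm_errorSymbol_le {z : ℂ} (hz : ‖z‖ = 1) {n L : ℕ} (hn : n ≠ 0) (hL : n ≤ L) :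
    ‖errorSymbol L n z‖ ≤ 8 * (n * ‖1 - z‖) ∧ ‖errorSymbol L n z‖ * (n * ‖1 - z‖) ≤ 16 := by
  have hx : 0 ≤ n * ‖1 - z‖ := by positivity
  have h6 := norm_hilbertSymbol_one_le_six hz L
  constructor
  · have : errorSymbol L n z
        = hilbertSymbol 1 n z - (1 - averageSymbol n z) * hilbertSymbol 1 L z := by
      rw [errorSymbol]; ring
    rw [this]
    refine (norm_sub_le _ _).trans ?_
    rw [norm_mul]
    have h1 := norm_hilbertSymbol_one_le hz n
    have h2 := mul_le_mul (norm_one_sub_averageSymbol_le hz hn) h6 (norm_nonneg _) hx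
    linarith
  · have h1 := norm_hilbertSymbol_one_sub_mul_le hz hL
    rw [norm_sub_rev] at h1
    have h2 := mul_le_mul (norm_averageSymbol_mul_le hz hn) h6 (norm_nonneg _) zero_le_two
    have h3 : ‖hilbertSymbol 1 n z - hilbertSymbol 1 L z‖ * (n * ‖1 - z‖) ≤ 4 := by
      rw [mul_left_comm]
      calc _ ≤ (n : ℝ) * (4 / (n + 1)) := by gcongr
        _ ≤ 4 := by
          rw [mul_div_assoc', div_le_iff₀ (by positivity)]
          linarith
    have h4 : ‖errorSymbol L n z‖ ≤ ‖hilbertSymbol 1 n z - hilbertSymbol 1 L z‖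
        + ‖averageSymbol n z‖ * ‖hilbertSymbol 1 L z‖ := by
      rw [← norm_mul]
      exact norm_add_le _ _
    have := mul_le_mul_of_nonneg_right h4 hx
    nlinarith

/-- The square function of the errors at the dyadic scales is bounded uniformly on the circle:
the `j`-th term is at most a constant times the minimum of `x` and `1 / x`, where
`x = 4 ^ j * |1 - z| ^ 2`. -/
theorem sum_norm_errorSymbol_le {z : ℂ} (hz : ‖z‖ = 1) (J : ℕ) :
    ∑ j ∈ Finset.range J, ‖errorSymbol (2 ^ J) (2 ^ j) z‖ ^ 2 ≤ 900 := by
  set y := ‖1 - z‖ ^ 2 with hy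
  have hy0 : 0 ≤ y := sq_nonneg _
  -- The minimum of `x` and `1 / x` is dominated by an increment of the bounded function `ψ`.
  set ψ : ℝ → ℝ := fun x => x / (1 + x) with hψ
  have step : ∀ j ∈ Finset.range J, ‖errorSymbol (2 ^ J) (2 ^ j) z‖ ^ 2
      ≤ 900 * (ψ (4 ^ (j + 1) * y) - ψ (4 ^ j * y)) := by
    intro j hj
    rw [Finset.mem_range] at hj
    obtain ⟨h1, h2⟩ := norm_errorSymbol_le hz (n := 2 ^ j) (L := 2 ^ J) (by positivity)
      (Nat.pow_le_pow_right two_pos hj.le)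
    set e := ‖errorSymbol (2 ^ J) (2 ^ j) z‖ with he
    have he0 : 0 ≤ e := norm_nonneg _
    set x := (4 : ℝ) ^ j * y with hx
    have hx0 : 0 ≤ x := by positivity
    have hxx : (((2 ^ j : ℕ) : ℝ) * ‖1 - z‖) ^ 2 = x := by
      rw [hx, hy, mul_pow]
      push_cast
      rw [← pow_mul, mul_comm j 2, pow_mul]
      norm_num
    have h1' : e ^ 2 ≤ 64 * x := by
      rw [← hxx]
      calc e ^ 2 ≤ (8 * (((2 ^ j : ℕ) : ℝ) * ‖1 - z‖)) ^ 2 := pow_le_pow_left₀ he0 h1 2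
        _ = _ := by ring
    have h2' : e ^ 2 * x ≤ 256 := by
      rw [← hxx, ← mul_pow]
      calc _ ≤ (16 : ℝ) ^ 2 := pow_le_pow_left₀ (by positivity) h2 2
        _ = _ := by norm_num
    have h4 : (4 : ℝ) ^ (j + 1) * y = 4 * x := by rw [hx]; ring
    rw [h4]
    have : ψ (4 * x) - ψ x = 3 * x / ((1 + 4 * x) * (1 + x)) := by
      simp only [hψ]
      field_simp
      ring
    rw [this, mul_div_assoc', le_div_iff₀ (by positivity)]
    have h5 : e ^ 2 * x * x ≤ 256 * x := mul_le_mul_of_nonneg_right h2' hx0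
    nlinarith
  refine (Finset.sum_le_sum step).trans ?_
  rw [← Finset.mul_sum, Finset.sum_range_sub (fun j => ψ (4 ^ j * y))]
  have h1 : ψ (4 ^ J * y) ≤ 1 := by
    simp only [hψ]
    rw [div_le_one (by positivity)]
    linarith
  have h2 : 0 ≤ ψ (4 ^ 0 * y) := by simp only [hψ]; positivity
  linarith

/-! ### Functional calculus of unitary operators -/

section Unitary

variable {E : Type*} [NormedAddCommGroup E] [InnerProductSpace ℂ E] [CompleteSpace E]

theorem continuousOn_spectrum_unitary {p : ℂ → ℂ} (hp : ContinuousOn p (Metric.sphere 0 1))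
    (V : unitary (E →L[ℂ] E)) : ContinuousOn p (spectrum ℂ (V : E →L[ℂ] E)) :=
  hp.mono (Unitary.spectrum_subset_circle V)

theorem norm_cfc_unitary_le (V : unitary (E →L[ℂ] E)) (p : ℂ → ℂ) {S : ℝ}
    (hS : ∀ z : ℂ, ‖z‖ = 1 → ‖p z‖ ≤ S) : ‖cfc p (V : E →L[ℂ] E)‖ ≤ S :=
  norm_cfc_le ((norm_nonneg _).trans (hS 1 (by simp))) fun z hz =>
    hS z (by simpa using Unitary.spectrum_subset_circle V hz)

/-- A square function of trigonometric polynomials in a unitary operator is bounded by the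
supremum of the square function of the symbols over the unit circle. -/
theorem sum_norm_cfc_unitary_sq_le (V : unitary (E →L[ℂ] E)) {ι : Type*} (s : Finset ι)
    (p : ι → ℂ → ℂ) (hp : ∀ i, ContinuousOn (p i) (Metric.sphere 0 1)) {S : ℝ}
    (hS : ∀ z : ℂ, ‖z‖ = 1 → ∑ i ∈ s, ‖p i z‖ ^ 2 ≤ S) (f : E) :
    ∑ i ∈ s, ‖cfc (p i) (V : E →L[ℂ] E) f‖ ^ 2 ≤ S * ‖f‖ ^ 2 := by
  have hc := fun i => continuousOn_spectrum_unitary (hp i) V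
  have h1 : ∑ i ∈ s, star (cfc (p i) (V : E →L[ℂ] E)) * cfc (p i) (V : E →L[ℂ] E)
      = cfc (∑ i ∈ s, fun z => star (p i z) * p i z) (V : E →L[ℂ] E) := by
    rw [cfc_sum (fun i z => star (p i z) * p i z) _ _ fun i _ => (hc i).star.mul (hc i)]
    refine Finset.sum_congr rfl fun i _ => ?_
    rw [cfc_mul _ _ _ (hc i).star (hc i), cfc_star]
  have h2 : ‖cfc (∑ i ∈ s, fun z => star (p i z) * p i z) (V : E →L[ℂ] E)‖ ≤ S := by
    refine norm_cfc_unitary_le V _ fun z hz => le_trans ?_ (hS z hz)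
    rw [Finset.sum_apply]
    refine (norm_sum_le _ _).trans (Finset.sum_le_sum fun i _ => ?_)
    rw [norm_mul, norm_star, sq]
  have h3 : ∀ i, ‖cfc (p i) (V : E →L[ℂ] E) f‖ ^ 2
      = RCLike.re (inner ℂ ((star (cfc (p i) (V : E →L[ℂ] E))
        * cfc (p i) (V : E →L[ℂ] E)) f) f) := by
    intro i
    rw [mul_apply_eq_comp, ContinuousLinearMap.star_eq_adjoint,
      ContinuousLinearMap.adjoint_inner_left, inner_self_eq_norm_sq]
  calc _ = RCLike.re (inner ℂ (cfc (∑ i ∈ s, fun z => star (p i z) * p i z)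
            (V : E →L[ℂ] E) f) f) := by
        rw [← h1, sum_apply, sum_inner, map_sum]
        exact Finset.sum_congr rfl fun i _ => h3 i
    _ ≤ ‖cfc (∑ i ∈ s, fun z => star (p i z) * p i z) (V : E →L[ℂ] E) f‖ * ‖f‖ :=
        re_inner_le_norm _ _
    _ ≤ (S * ‖f‖) * ‖f‖ := by
        gcongr
        exact ContinuousLinearMap.le_of_opNorm_le _ h2 f
    _ = _ := by ring

/-- A trigonometric polynomial in a unitary operator is the corresponding combination of powers. -/
theorem cfc_unitary_sum_zpow (V : unitary (E →L[ℂ] E)) {ι : Type*} (s : Finset ι)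
    (c : ι → ℂ) (e : ι → ℤ) :
    cfc (fun z => ∑ i ∈ s, c i * z ^ e i) (V : E →L[ℂ] E)
      = ∑ i ∈ s, c i • ((V ^ e i : unitary (E →L[ℂ] E)) : E →L[ℂ] E) := by
  have hz : ∀ k : ℤ, ContinuousOn (fun z : ℂ => z ^ k) (spectrum ℂ (V : E →L[ℂ] E)) := fun k =>
    continuousOn_spectrum_unitary (continuousOn_id.zpow₀ k fun z hz =>
      Or.inl (by rintro rfl; simp at hz)) V
  have h : (fun z : ℂ => ∑ i ∈ s, c i * z ^ e i) = ∑ i ∈ s, fun z => c i * z ^ e i := by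
    ext z; simp
  rw [h, cfc_sum (fun i z => c i * z ^ e i) _ _ fun i _ => continuousOn_const.mul (hz _)]
  refine Finset.sum_congr rfl fun i _ => ?_
  rw [cfc_const_mul _ _ _ (hz _)]
  congr 1
  have := cfc_zpow (R := ℂ) (Unitary.toUnits V) (e i)
    (show IsStarNormal (Unitary.toUnits V : E →L[ℂ] E) from by
      simpa using (inferInstance : IsStarNormal (V : E →L[ℂ] E)))
  rw [← map_zpow] at this
  exact this

end Unitary

theorem continuousOn_hilbertSymbol (c : ℤ → ℂ) (n : ℕ) :
    ContinuousOn (hilbertSymbol c n) (Metric.sphere 0 1) := by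
  unfold hilbertSymbol
  refine continuousOn_finsetSum _ fun k _ => ContinuousOn.div_const (continuousOn_const.mul
    (continuousOn_id.zpow₀ k fun z hz => Or.inl (by rintro rfl; simp at hz))) _

theorem continuous_averageSymbol (n : ℕ) : Continuous (averageSymbol n) := by
  unfold averageSymbol
  fun_prop

/-! ### Twisted Koopman operators -/

section Koopman

variable {X : Type u} [MeasurableSpace X] {μ : Measure X} {T : X ≃ᵐ X}

/-- The Koopman operator of an invertible measure preserving transformation, as a linear isometric
equivalence of `L²`. -/
def koopmanEquiv (hT : MeasurePreserving T μ μ) : Lp ℂ 2 μ ≃ₗᵢ[ℂ] Lp ℂ 2 μ :=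
  LinearIsometryEquiv.ofSurjective (Lp.compMeasurePreservingₗᵢ ℂ T hT) fun f => by
    refine ⟨Lp.compMeasurePreserving T.symm (hT.symm T) f, ?_⟩
    change Lp.compMeasurePreserving T hT (Lp.compMeasurePreserving T.symm (hT.symm T) f) = f
    rw [← Lp.compMeasurePreserving_comp_apply f (hT.symm T) hT]
    have : (T.symm ∘ T : X → X) = id := by ext x; simp
    simp [this]

/-- The unitary operator `f ↦ ξ • f ∘ T` on `L²`, for `|ξ| = 1`. -/
def koopman (hT : MeasurePreserving T μ μ) {ξ : ℂ} (hξ : ‖ξ‖ = 1) :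
    unitary (Lp ℂ 2 μ →L[ℂ] Lp ℂ 2 μ) :=
  ⟨ξ • ((Unitary.linearIsometryEquiv.symm (koopmanEquiv hT) :
      unitary (Lp ℂ 2 μ →L[ℂ] Lp ℂ 2 μ)) : Lp ℂ 2 μ →L[ℂ] Lp ℂ 2 μ), by
    have h1 : star ξ * ξ = 1 := by
      have := Complex.conj_mul' ξ
      rw [hξ] at this
      simpa using this
    rw [Unitary.mem_iff, star_smul, smul_mul_smul_comm, smul_mul_smul_comm, mul_comm ξ, h1,
      one_smul, one_smul]
    exact ⟨Unitary.coe_star_mul_self _, Unitary.coe_mul_star_self _⟩⟩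

theorem coeFn_koopman (hT : MeasurePreserving T μ μ) {ξ : ℂ} (hξ : ‖ξ‖ = 1) (f : Lp ℂ 2 μ) :
    (koopman hT hξ : Lp ℂ 2 μ →L[ℂ] Lp ℂ 2 μ) f =ᵐ[μ] fun x => ξ * f (T x) := by
  have : (koopman hT hξ : Lp ℂ 2 μ →L[ℂ] Lp ℂ 2 μ) f
      = ξ • Lp.compMeasurePreserving T hT f := rfl
  rw [this]
  filter_upwards [Lp.coeFn_smul ξ (Lp.compMeasurePreserving T hT f),
    Lp.coeFn_compMeasurePreserving f hT] with x h1 h2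
  rw [h1, Pi.smul_apply, h2, smul_eq_mul, Function.comp_apply]

theorem measurePreserving_zpow (hT : MeasurePreserving T μ μ) (k : ℤ) :
    MeasurePreserving (T.toEquiv ^ k : Equiv.Perm X) μ μ := by
  induction k using Int.induction_on with
  | zero => exact MeasurePreserving.id μ
  | succ k ih =>
    rw [zpow_add_one]
    exact ih.comp hT
  | pred k ih =>
    rw [zpow_sub_one]
    exact ih.comp (hT.symm T)

theorem coeFn_koopman_zpow (hT : MeasurePreserving T μ μ) {ξ : ℂ} (hξ : ‖ξ‖ = 1) (k : ℤ)
    (f : Lp ℂ 2 μ) :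
    ((koopman hT hξ ^ k : unitary (Lp ℂ 2 μ →L[ℂ] Lp ℂ 2 μ)) : Lp ℂ 2 μ →L[ℂ] Lp ℂ 2 μ) f
      =ᵐ[μ] fun x => ξ ^ k * f ((T.toEquiv ^ k : Equiv.Perm X) x) := by
  have hξ0 : ξ ≠ 0 := by rintro rfl; simp at hξ
  set V := koopman hT hξ with hV
  induction k using Int.induction_on with
  | zero => simp
  | succ k ih =>
    have h1 : ((V ^ ((k : ℤ) + 1) : unitary (Lp ℂ 2 μ →L[ℂ] Lp ℂ 2 μ)) : Lp ℂ 2 μ →L[ℂ] Lp ℂ 2 μ) f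
        = (V : Lp ℂ 2 μ →L[ℂ] Lp ℂ 2 μ)
          (((V ^ (k : ℤ) : unitary (Lp ℂ 2 μ →L[ℂ] Lp ℂ 2 μ)) : Lp ℂ 2 μ →L[ℂ] Lp ℂ 2 μ) f) := by
      rw [add_comm, zpow_one_add]; rfl
    rw [h1]
    filter_upwards [coeFn_koopman hT hξ (((V ^ (k : ℤ) : unitary (Lp ℂ 2 μ →L[ℂ] Lp ℂ 2 μ)) :
      Lp ℂ 2 μ →L[ℂ] Lp ℂ 2 μ) f), hT.quasiMeasurePreserving.ae ih] with x h2 h3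
    rw [h2, h3, zpow_add_one₀ hξ0, zpow_add_one, Equiv.Perm.mul_apply]
    simp only [MeasurableEquiv.coe_toEquiv]
    ring
  | pred k ih =>
    set g := ((V ^ (-(k : ℤ) - 1) : unitary (Lp ℂ 2 μ →L[ℂ] Lp ℂ 2 μ)) :
      Lp ℂ 2 μ →L[ℂ] Lp ℂ 2 μ) f with hg
    have h1 : (V : Lp ℂ 2 μ →L[ℂ] Lp ℂ 2 μ) g
        = ((V ^ (-(k : ℤ)) : unitary (Lp ℂ 2 μ →L[ℂ] Lp ℂ 2 μ)) :
          Lp ℂ 2 μ →L[ℂ] Lp ℂ 2 μ) f := by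
      have : V ^ (-(k : ℤ)) = V * V ^ (-(k : ℤ) - 1) := by
        rw [← zpow_one_add]; congr 1; ring
      rw [this]; rfl
    have h2 := coeFn_koopman hT hξ g
    rw [← hV, h1] at h2
    have h3 := (hT.symm T).quasiMeasurePreserving.ae (ih.symm.trans h2)
    filter_upwards [h3] with x hx
    simp only [MeasurableEquiv.apply_symm_apply] at hx
    have h4 : (T.toEquiv ^ (-(k : ℤ) - 1) : Equiv.Perm X) x
        = (T.toEquiv ^ (-(k : ℤ)) : Equiv.Perm X) (T.symm x) := by
      rw [zpow_sub_one, Equiv.Perm.mul_apply]; rfl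
    rw [h4, zpow_sub_one₀ hξ0, mul_right_comm, hx]
    field_simp

theorem coeFn_finset_sum {ι : Type*} (s : Finset ι) (g : ι → Lp ℂ 2 μ) :
    (∑ i ∈ s, g i : Lp ℂ 2 μ) =ᵐ[μ] fun x => ∑ i ∈ s, g i x := by
  classical
  induction s using Finset.induction_on with
  | empty =>
    simp only [Finset.sum_empty]
    exact Lp.coeFn_zero ℂ 2 μ
  | insert i s hi ih =>
    rw [Finset.sum_insert hi]
    filter_upwards [Lp.coeFn_add (g i) (∑ i ∈ s, g i), ih] with x h1 h2
    rw [h1, Pi.add_apply, h2, Finset.sum_insert hi]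

theorem coeFn_cfc_koopman (hT : MeasurePreserving T μ μ) {ξ : ℂ} (hξ : ‖ξ‖ = 1) {ι : Type*}
    (s : Finset ι) (c : ι → ℂ) (e : ι → ℤ) (f : Lp ℂ 2 μ) :
    cfc (fun z => ∑ i ∈ s, c i * z ^ e i) (koopman hT hξ : Lp ℂ 2 μ →L[ℂ] Lp ℂ 2 μ) f
      =ᵐ[μ] fun x => ∑ i ∈ s, c i * (ξ ^ e i * f ((T.toEquiv ^ e i : Equiv.Perm X) x)) := by
  rw [cfc_unitary_sum_zpow, sum_apply]
  have h : ∀ i ∈ s, ∀ᵐ x ∂μ, ((c i • ((koopman hT hξ ^ e i : unitary (Lp ℂ 2 μ →L[ℂ] Lp ℂ 2 μ)) :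
      Lp ℂ 2 μ →L[ℂ] Lp ℂ 2 μ)) f) x
      = c i * (ξ ^ e i * f ((T.toEquiv ^ e i : Equiv.Perm X) x)) := by
    intro i _
    filter_upwards [Lp.coeFn_smul (c i) (((koopman hT hξ ^ e i :
      unitary (Lp ℂ 2 μ →L[ℂ] Lp ℂ 2 μ)) : Lp ℂ 2 μ →L[ℂ] Lp ℂ 2 μ) f),
      coeFn_koopman_zpow hT hξ (e i) f] with x h1 h2
    rw [smul_apply, h1, Pi.smul_apply, h2, smul_eq_mul]
  filter_upwards [coeFn_finset_sum s _, (Finset.eventually_all s).2 h] with x h1 h2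
  rw [h1]
  exact Finset.sum_congr rfl h2

/-- The operator with symbol `hilbertSymbol c n` is the truncated ergodic Hilbert transform. -/
theorem coeFn_cfc_hilbertSymbol (hT : MeasurePreserving T μ μ) {ξ : ℂ} (hξ : ‖ξ‖ = 1)
    (c : ℤ → ℂ) (n : ℕ) (f : Lp ℂ 2 μ) :
    cfc (hilbertSymbol c n) (koopman hT hξ : Lp ℂ 2 μ →L[ℂ] Lp ℂ 2 μ) f
      =ᵐ[μ] modulatedSum (fun k => c k * ξ ^ k) T.toEquiv f n := by
  have : hilbertSymbol c n = fun z => ∑ k ∈ (Finset.Icc (-(n : ℤ)) (n : ℤ)).erase 0,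
      (c k / k) * z ^ k := by
    ext z
    exact Finset.sum_congr rfl fun k _ => by ring
  rw [this]
  filter_upwards [coeFn_cfc_koopman hT hξ _ _ (fun k => k) f] with x hx
  rw [hx]
  exact Finset.sum_congr rfl fun k _ => by ring

theorem coeFn_cfc_averageSymbol (hT : MeasurePreserving T μ μ) {ξ : ℂ} (hξ : ‖ξ‖ = 1)
    (n : ℕ) (f : Lp ℂ 2 μ) :
    cfc (averageSymbol n) (koopman hT hξ : Lp ℂ 2 μ →L[ℂ] Lp ℂ 2 μ) f
      =ᵐ[μ] fun x => (n : ℂ)⁻¹ * ∑ i ∈ Finset.range n, ξ ^ i * f (T^[i] x) := by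
  have : averageSymbol n = fun z => ∑ i ∈ Finset.range n, (n : ℂ)⁻¹ * z ^ (i : ℤ) := by
    ext z
    simp [averageSymbol, Finset.mul_sum]
  rw [this]
  filter_upwards [coeFn_cfc_koopman hT hξ (Finset.range n) (fun _ => (n : ℂ)⁻¹)
    (fun k => (k : ℤ)) f] with x hx
  rw [hx, Finset.mul_sum]
  refine Finset.sum_congr rfl fun k _ => ?_
  rw [zpow_natCast, zpow_natCast, Equiv.Perm.coe_pow]
  rfl

end Koopman

/-! ### Almost everywhere convergence of functions in `L²` -/

section Convergence

variable {X : Type u} [MeasurableSpace X] {μ : Measure X}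

theorem lintegral_enorm_sq (g : Lp ℂ 2 μ) :
    ∫⁻ x, ‖g x‖ₑ ^ 2 ∂μ = ENNReal.ofReal (‖g‖ ^ 2) := by
  have h := eLpNorm_nnreal_pow_eq_lintegral (μ := μ) (f := g) (p := 2) two_ne_zero
  rw [ENNReal.ofReal_pow (norm_nonneg _), ofReal_norm, Lp.enorm_def]
  simpa using h.symm

theorem measurable_enorm_sq (g : Lp ℂ 2 μ) : Measurable fun x => ‖g x‖ₑ ^ 2 :=
  (Lp.stronglyMeasurable g).measurable.enorm.pow_const 2

theorem lt_norm_iff_enorm_sq {t : ℝ} (ht : 0 ≤ t) (w : ℂ) :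
    t < ‖w‖ ↔ ENNReal.ofReal t ^ 2 < ‖w‖ₑ ^ 2 := by
  rw [(ENNReal.pow_right_strictMono two_ne_zero).lt_iff_lt, ← ofReal_norm,
    ENNReal.ofReal_lt_ofReal_iff_of_nonneg ht]

theorem measure_lt_norm_le (g : Lp ℂ 2 μ) {t : ℝ} (ht : 0 < t) :
    μ {x | t < ‖g x‖} ≤ ENNReal.ofReal (‖g‖ ^ 2 / t ^ 2) := by
  have h := mul_meas_ge_le_lintegral (μ := μ) (measurable_enorm_sq g) (ENNReal.ofReal t ^ 2)
  rw [lintegral_enorm_sq] at h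
  rw [ENNReal.ofReal_div_of_pos (by positivity), ENNReal.ofReal_pow ht.le,
    ENNReal.le_div_iff_mul_le (by left; simpa using ht) (by left; simp), mul_comm]
  refine le_trans (mul_le_mul_right (measure_mono fun x hx => ?_) _) h
  exact ((lt_norm_iff_enorm_sq ht.le _).1 hx).le

theorem measure_exists_lt_norm_le {ι : Type*} (s : Finset ι) (g : ι → Lp ℂ 2 μ) {t : ℝ}
    (ht : 0 < t) :
    μ {x | ∃ i ∈ s, t < ‖g i x‖} ≤ ENNReal.ofReal ((∑ i ∈ s, ‖g i‖ ^ 2) / t ^ 2) := by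
  have : {x | ∃ i ∈ s, t < ‖g i x‖} = ⋃ i ∈ s, {x | t < ‖g i x‖} := by ext x; simp
  rw [this, Finset.sum_div, ENNReal.ofReal_sum_of_nonneg fun i _ => by positivity]
  exact (measure_biUnion_finset_le s _).trans
    (Finset.sum_le_sum fun i _ => measure_lt_norm_le (g i) ht)

theorem ae_tendsto_zero_of_tsum_lintegral_ne_top (G : ℕ → X → ENNReal)
    (hG : ∀ n, Measurable (G n)) (h : ∑' n, ∫⁻ x, G n x ∂μ ≠ ⊤) :
    ∀ᵐ x ∂μ, Tendsto (fun n => G n x) atTop (𝓝 0) := by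
  rw [← lintegral_tsum fun n => (hG n).aemeasurable] at h
  filter_upwards [ae_lt_top (Measurable.tsum hG) h] with x hx
  exact ENNReal.tendsto_atTop_zero_of_tsum_ne_top hx.ne

/-- Functions in `L²` which are Cauchy with a summable rate for the squared distances converge
almost everywhere. -/
theorem ae_exists_tendsto_of_norm_sub_sq_le (g : ℕ → Lp ℂ 2 μ) (ρ : ℕ → ℝ) (hρ : Summable ρ)
    (h : ∀ n L, n ≤ L → ‖g L - g n‖ ^ 2 ≤ ρ n) :
    ∀ᵐ x ∂μ, ∃ l : ℂ, Tendsto (fun n => g n x) atTop (𝓝 l) := by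
  have hc : CauchySeq g := by
    have h0 : Tendsto (fun n => Real.sqrt (ρ n)) atTop (𝓝 0) := by
      simpa [Function.comp_def] using
        (Real.continuous_sqrt.tendsto 0).comp hρ.tendsto_atTop_zero
    refine cauchySeq_of_le_tendsto_0' (fun n => Real.sqrt (ρ n)) (fun n L hnL => ?_) h0
    rw [dist_comm, dist_eq_norm]
    exact Real.le_sqrt_of_sq_le (h n L hnL)
  obtain ⟨g', hg'⟩ := cauchySeq_tendsto_of_complete hc
  have h' : ∀ n, ‖g' - g n‖ ^ 2 ≤ ρ n := fun n =>
    le_of_tendsto (((hg'.sub_const (g n)).norm).pow 2)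
      (eventually_atTop.2 ⟨n, fun L hL => h n L hL⟩)
  have hsum : ∑' n, ∫⁻ x, ‖(g' - g n) x‖ₑ ^ 2 ∂μ ≠ ⊤ := by
    simp_rw [lintegral_enorm_sq]
    exact (Summable.of_nonneg_of_le (fun n => by positivity) h' hρ).tsum_ofReal_ne_top
  have h1 := ae_tendsto_zero_of_tsum_lintegral_ne_top _ (fun n => measurable_enorm_sq _) hsum
  have h2 : ∀ᵐ x ∂μ, ∀ n, (g' - g n) x = g' x - g n x :=
    ae_all_iff.2 fun n => Lp.coeFn_sub g' (g n)
  filter_upwards [h1, h2] with x h3 h4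
  refine ⟨g' x, ?_⟩
  rw [tendsto_iff_norm_sub_tendsto_zero]
  have h5 : Tendsto (fun n => ‖(g' - g n) x‖ ^ 2) atTop (𝓝 0) := by
    have := (ENNReal.tendsto_toReal ENNReal.zero_ne_top).comp h3
    simpa [Function.comp_def] using this
  have h6 := (Real.continuous_sqrt.tendsto 0).comp h5
  simp only [Real.sqrt_zero] at h6
  refine h6.congr fun n => ?_
  rw [Function.comp_apply, Real.sqrt_sq (norm_nonneg _), h4, norm_sub_rev]

/-- Banach principle: for a sequence of operators on `L²` with a maximal inequality of weak
type `(2, 2)`, the functions on which it converges almost everywhere form a closed set. -/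
theorem isClosed_setOf_ae_exists_tendsto (H : ℕ → Lp ℂ 2 μ →L[ℂ] Lp ℂ 2 μ) (C : ℝ)
    (hH : ∀ f : Lp ℂ 2 μ, ∀ t : ℝ, 0 < t →
      μ {x | ∃ n, t < ‖H n f x‖} ≤ ENNReal.ofReal (C * ‖f‖ ^ 2 / t ^ 2)) :
    IsClosed {f : Lp ℂ 2 μ | ∀ᵐ x ∂μ, ∃ l : ℂ, Tendsto (fun n => H n f x) atTop (𝓝 l)} := by
  refine isClosed_of_closure_subset fun f hf => ?_
  obtain ⟨h, hh, hlim⟩ := mem_closure_iff_seq_limit.1 hf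
  have bad : ∀ t : ℝ, 0 < t →
      ∀ᵐ x ∂μ, ∃ N, ∀ n ≥ N, ‖H n f x - H N f x‖ < 3 * t := by
    intro t ht
    set S := {x | ¬ ∃ N, ∀ n ≥ N, ‖H n f x - H N f x‖ < 3 * t} with hS
    have hle : ∀ i, μ S ≤ ENNReal.ofReal (C * ‖f - h i‖ ^ 2 / t ^ 2) := by
      intro i
      refine le_trans (measure_mono_ae ?_) (hH (f - h i) t ht)
      have hsub : ∀ᵐ x ∂μ, ∀ n, H n (f - h i) x = H n f x - H n (h i) x :=
        ae_all_iff.2 fun n => by rw [map_sub]; exact Lp.coeFn_sub _ _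
      filter_upwards [hsub, hh i] with x hx ⟨l, hl⟩ hxS
      by_contra hcon
      change ¬ ∃ n, t < ‖H n (f - h i) x‖ at hcon
      push Not at hcon
      obtain ⟨N, hN⟩ := Metric.cauchySeq_iff'.1 hl.cauchySeq t ht
      refine hxS ⟨N, fun n hn => ?_⟩
      have h1 := hN n hn
      rw [dist_eq_norm] at h1
      have h2 := hcon n
      have h3 := hcon N
      rw [hx] at h2 h3
      have : H n f x - H N f x = (H n f x - H n (h i) x) - (H N f x - H N (h i) x)
          + (H n (h i) x - H N (h i) x) := by ring
      rw [this]
      refine (norm_add_le _ _).trans_lt ?_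
      have := norm_sub_le (H n f x - H n (h i) x) (H N f x - H N (h i) x)
      linarith
    have h0 : Tendsto (fun i => ENNReal.ofReal (C * ‖f - h i‖ ^ 2 / t ^ 2)) atTop (𝓝 0) := by
      have h1 : Tendsto (fun i => ‖f - h i‖) atTop (𝓝 0) := by
        simpa using (hlim.const_sub f).norm
      simpa using ENNReal.tendsto_ofReal (((h1.pow 2).const_mul C).div_const (t ^ 2))
    exact nonpos_iff_eq_zero.1 (ge_of_tendsto' h0 hle)
  have hall : ∀ᵐ x ∂μ, ∀ m : ℕ, ∃ N, ∀ n ≥ N,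
      ‖H n f x - H N f x‖ < 3 * (1 / ((m : ℝ) + 1)) :=
    ae_all_iff.2 fun m => bad _ (by positivity)
  filter_upwards [hall] with x hx
  refine cauchySeq_tendsto_of_complete (Metric.cauchySeq_iff'.2 fun ε hε => ?_)
  obtain ⟨m, hm⟩ := exists_nat_one_div_lt (show 0 < ε / 3 by positivity)
  obtain ⟨N, hN⟩ := hx m
  refine ⟨N, fun n hn => ?_⟩
  rw [dist_eq_norm]
  linarith [hN n hn]

end Convergence

/-! ### The maximal ergodic inequality -/

section Maximal

/-- Covering argument along an orbit: a segment is exhausted greedily by stretches on which the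
average of `g` exceeds `t`. -/
theorem mul_sum_indicator_le_sum {X : Type*} {T : X → X} (g : X → ENNReal) (t : ENNReal) (N : ℕ)
    {E : Set X}
    (hE : ∀ x ∈ E, ∃ n, 0 < n ∧ n ≤ N ∧ t * n ≤ ∑ k ∈ Finset.range n, g (T^[k] x))
    (L : ℕ) : ∀ x, t * ∑ i ∈ Finset.range L, E.indicator 1 (T^[i] x)
      ≤ ∑ i ∈ Finset.range (L + N), g (T^[i] x) := by
  induction L using Nat.strong_induction_on with
  | _ L ih =>
    intro x
    have split : ∀ {M n : ℕ} (F : X → ENNReal), n ≤ M → ∑ i ∈ Finset.range M, F (T^[i] x)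
        = ∑ i ∈ Finset.range n, F (T^[i] x) + ∑ i ∈ Finset.range (M - n), F (T^[i] (T^[n] x)) := by
      intro M n F h
      obtain ⟨d, rfl⟩ := Nat.exists_eq_add_of_le h
      rw [Finset.sum_range_add, Nat.add_sub_cancel_left]
      congr 1
      exact Finset.sum_congr rfl fun i _ => by rw [← Function.iterate_add_apply, add_comm]
    rcases Nat.eq_zero_or_pos L with rfl | hL
    · simp
    by_cases hx : x ∈ E
    · obtain ⟨n, hn0, hnN, hn⟩ := hE x hx
      have hone : ∀ m, ∑ i ∈ Finset.range m, E.indicator (1 : X → ENNReal) (T^[i] x) ≤ m := by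
        intro m
        refine (Finset.sum_le_sum (g := fun _ => (1 : ENNReal)) fun i _ => ?_).trans (by simp)
        exact Set.indicator_apply_le' (fun _ => le_rfl) fun _ => zero_le
      rcases le_total n L with h | h
      · rw [split _ h, split (M := L + N) g (h.trans (Nat.le_add_right L N)), mul_add]
        refine add_le_add ((mul_le_mul_right (hone n) t).trans hn) ?_
        rw [show L + N - n = (L - n) + N by omega]
        exact ih (L - n) (by omega) _
      · calc _ ≤ t * n := mul_le_mul_right ((hone L).trans (by exact_mod_cast h)) t
          _ ≤ _ := hn
          _ ≤ _ := Finset.sum_le_sum_of_subset (Finset.range_mono (by omega))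
    · rw [split _ hL, split (M := L + N) (n := 1) g (by omega), mul_add]
      refine add_le_add (by simp [hx]) ?_
      rw [show L + N - 1 = (L - 1) + N by omega]
      exact ih (L - 1) (by omega) _

theorem le_of_forall_nat_mul_le {a b c : ENNReal} (hc : c ≠ ⊤)
    (h : ∀ L : ℕ, L * a ≤ L * b + c) : a ≤ b := by
  rcases eq_or_ne b ⊤ with rfl | hb
  · exact le_top
  have ha : a ≠ ⊤ := by
    have h1 := h 1
    simp only [Nat.cast_one, one_mul] at h1
    exact ne_top_of_le_ne_top (ENNReal.add_ne_top.2 ⟨hb, hc⟩) h1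
  lift a to NNReal using ha
  lift b to NNReal using hb
  lift c to NNReal using hc
  norm_cast at h ⊢
  by_contra! hab
  have hpos : (0 : ℝ) < a - b := sub_pos.2 (by exact_mod_cast hab)
  obtain ⟨L, hL⟩ := exists_nat_gt ((c : ℝ) / (a - b))
  rw [div_lt_iff₀ hpos] at hL
  have h1 : (L : ℝ) * a ≤ L * b + c := by exact_mod_cast h L
  linarith

variable {X : Type u} [MeasurableSpace X] {μ : Measure X}

/-- The maximal ergodic inequality for nonnegative functions. -/
theorem mul_measure_exists_lt_sum_le {T : X → X} (hT : MeasurePreserving T μ μ)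
    (g : X → ENNReal) (hg : Measurable g) (t : ENNReal) :
    t * μ {x | ∃ n : ℕ, 0 < n ∧ t * n < ∑ k ∈ Finset.range n, g (T^[k] x)} ≤ ∫⁻ x, g x ∂μ := by
  set E : ℕ → Set X := fun N =>
    {x | ∃ n : ℕ, 0 < n ∧ n ≤ N ∧ t * n < ∑ k ∈ Finset.range n, g (T^[k] x)} with hEdef
  have hmeas : ∀ n : ℕ, Measurable fun x => ∑ k ∈ Finset.range n, g (T^[k] x) := fun n =>
    Finset.measurable_sum _ fun k _ => hg.comp (hT.measurable.iterate k)
  have hE : ∀ N, MeasurableSet (E N) := by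
    intro N
    have : E N = ⋃ n ∈ Finset.Icc 1 N, {x | t * n < ∑ k ∈ Finset.range n, g (T^[k] x)} := by
      ext x
      simp only [hEdef, Set.mem_ofPred_eq, Set.mem_iUnion, Finset.mem_Icc, exists_prop, and_assoc]
      rfl
    rw [this]
    exact Finset.measurableSet_biUnion _ fun n _ => measurableSet_lt measurable_const (hmeas n)
  have hbound : ∀ N, t * μ (E N) ≤ ∫⁻ x, g x ∂μ := by
    intro N
    rcases eq_or_ne (∫⁻ x, g x ∂μ) ⊤ with htop | htop
    · rw [htop]; exact le_top
    refine le_of_forall_nat_mul_le (c := N * ∫⁻ x, g x ∂μ)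
      (ENNReal.mul_ne_top (ENNReal.natCast_ne_top N) htop) fun L => ?_
    have h1 := lintegral_mono (μ := μ) (mul_sum_indicator_le_sum (T := T) g t N (E := E N)
      (fun x ⟨n, h0, h1, h2⟩ => ⟨n, h0, h1, h2.le⟩) L)
    have hind : ∀ i, Measurable fun x => (E N).indicator (1 : X → ENNReal) (T^[i] x) := fun i =>
      (measurable_one.indicator (hE N)).comp (hT.measurable.iterate i)
    rw [lintegral_const_mul _ (Finset.measurable_sum _ fun i _ => hind i),
      lintegral_finsetSum _ fun i _ => hind i,
      lintegral_finsetSum (f := fun i x => g (T^[i] x)) _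
        fun i _ => hg.comp (hT.measurable.iterate i)] at h1
    have h2 : ∀ i, ∫⁻ x, (E N).indicator (1 : X → ENNReal) (T^[i] x) ∂μ = μ (E N) := fun i => by
      rw [(hT.iterate i).lintegral_comp (measurable_one.indicator (hE N)),
        lintegral_indicator_one (hE N)]
    have h3 : ∀ i, ∫⁻ x, g (T^[i] x) ∂μ = ∫⁻ x, g x ∂μ := fun i =>
      (hT.iterate i).lintegral_comp hg
    simp only [h2, h3, Finset.sum_const, Finset.card_range, nsmul_eq_mul, Nat.cast_add,
      add_mul] at h1
    rwa [mul_left_comm] at h1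
  have hU : {x | ∃ n : ℕ, 0 < n ∧ t * n < ∑ k ∈ Finset.range n, g (T^[k] x)} = ⋃ N, E N := by
    ext x
    simp only [hEdef, Set.mem_ofPred_eq, Set.mem_iUnion]
    exact ⟨fun ⟨n, h0, h1⟩ => ⟨n, n, h0, le_rfl, h1⟩, fun ⟨_, n, h0, _, h1⟩ => ⟨n, h0, h1⟩⟩
  have hmono : Monotone E := fun N M h x ⟨n, h0, h1, h2⟩ => ⟨n, h0, h1.trans h, h2⟩
  rw [hU, hmono.measure_iUnion, ENNReal.mul_iSup]
  exact iSup_le hbound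

/-- The maximal ergodic inequality of weak type `(2, 2)`, deduced from the one for `‖f‖ ^ 2` by
the Cauchy–Schwarz inequality. -/
theorem measure_exists_lt_sum_norm_le {T : X → X} (hT : MeasurePreserving T μ μ)
    (f : Lp ℂ 2 μ) {t : ℝ} (ht : 0 < t) :
    μ {x | ∃ n : ℕ, t * n < ∑ k ∈ Finset.range n, ‖f (T^[k] x)‖}
      ≤ ENNReal.ofReal (‖f‖ ^ 2 / t ^ 2) := by
  have h := mul_measure_exists_lt_sum_le hT _ (measurable_enorm_sq f) (ENNReal.ofReal (t ^ 2))
  rw [lintegral_enorm_sq] at h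
  rw [ENNReal.ofReal_div_of_pos (by positivity),
    ENNReal.le_div_iff_mul_le (by left; simpa using ht.ne') (by left; simp), mul_comm]
  refine le_trans (mul_le_mul_right (measure_mono ?_) _) h
  rintro x ⟨n, hn⟩
  have hn0 : 0 < n := Nat.pos_of_ne_zero (by rintro rfl; simp at hn)
  have hn0' : (0 : ℝ) < n := by exact_mod_cast hn0
  refine ⟨n, hn0, ?_⟩
  have h1 : t ^ 2 * n < ∑ k ∈ Finset.range n, ‖f (T^[k] x)‖ ^ 2 := by
    have h2 := sq_sum_le_card_mul_sum_sq (s := Finset.range n) (f := fun k => ‖f (T^[k] x)‖)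
    rw [Finset.card_range] at h2
    have h3 : (t * n) ^ 2 < (∑ k ∈ Finset.range n, ‖f (T^[k] x)‖) ^ 2 :=
      pow_lt_pow_left₀ hn (by positivity) two_ne_zero
    refine lt_of_mul_lt_mul_left ?_ hn0'.le
    calc (n : ℝ) * (t ^ 2 * n) = (t * n) ^ 2 := by ring
      _ < _ := h3.trans_le h2
  have h4 : ∑ k ∈ Finset.range n, ‖f (T^[k] x)‖ₑ ^ 2
      = ENNReal.ofReal (∑ k ∈ Finset.range n, ‖f (T^[k] x)‖ ^ 2) := by
    rw [ENNReal.ofReal_sum_of_nonneg fun k _ => by positivity]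
    refine Finset.sum_congr rfl fun k _ => ?_
    rw [ENNReal.ofReal_pow (norm_nonneg _), ofReal_norm]
  rw [h4, ← ENNReal.ofReal_natCast, ← ENNReal.ofReal_mul (by positivity)]
  exact (ENNReal.ofReal_lt_ofReal_iff_of_nonneg (by positivity)).2 h1

end Maximal

/-! ### The ergodic Hilbert transform modulated by a character -/

section Character

variable {X : Type u} [MeasurableSpace X] {μ : Measure X} {T : X ≃ᵐ X}

theorem iterate_symm_eq (k : ℕ) (x : X) :
    (T.toEquiv ^ (-(k : ℤ)) : Equiv.Perm X) x = T.symm^[k] x := by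
  rw [zpow_neg, zpow_natCast, ← inv_pow, Equiv.Perm.coe_pow]
  rfl

theorem iterate_eq (k : ℕ) (x : X) :
    (T.toEquiv ^ (k : ℤ) : Equiv.Perm X) x = T^[k] x := by
  rw [zpow_natCast, Equiv.Perm.coe_pow]
  rfl

theorem modulatedSum_sub (a : ℤ → ℂ) (f : X → ℂ) {n m : ℕ} (hnm : n ≤ m) (x : X) :
    modulatedSum a T.toEquiv f m x - modulatedSum a T.toEquiv f n x
      = ∑ k ∈ Finset.Ico n m, (a (k + 1) * f (T^[k + 1] x) / (k + 1)
        - a (-(k + 1)) * f (T.symm^[k + 1] x) / (k + 1)) := by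
  unfold modulatedSum
  rw [sum_erase_zero_eq, sum_erase_zero_eq, Finset.sum_Ico_eq_sub _ hnm]
  congr 1 <;>
  · refine Finset.sum_congr rfl fun k _ => ?_
    have h1 := iterate_eq (T := T) (k + 1) x
    have h2 := iterate_symm_eq (T := T) (k + 1) x
    push_cast at h1 h2 ⊢
    rw [h1, h2, div_neg, sub_eq_add_neg]

/-- The increment of a modulated Hilbert transform over `n < |k| ≤ m`, with modulus of the
coefficients at most `B`, is controlled by sums of `|f|` along the orbit. -/
theorem norm_modulatedSum_sub_le (a : ℤ → ℂ) {B : ℝ} (ha : ∀ k, ‖a k‖ ≤ B) (f : X → ℂ)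
    {N n m : ℕ} (hN : 0 < N) (hNn : N ≤ n) (hnm : n ≤ m) (x : X) :
    ‖modulatedSum a T.toEquiv f m x - modulatedSum a T.toEquiv f n x‖
      ≤ B / N * ∑ k ∈ Finset.Ico n m, (‖f (T^[k + 1] x)‖ + ‖f (T.symm^[k + 1] x)‖) := by
  have hB : 0 ≤ B := (norm_nonneg _).trans (ha 0)
  have hN' : (0 : ℝ) < N := by exact_mod_cast hN
  rw [modulatedSum_sub _ _ hnm, Finset.mul_sum]
  refine (norm_sum_le _ _).trans (Finset.sum_le_sum fun k hk => ?_)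
  have hk1 : (N : ℝ) ≤ k + 1 := by
    have := (Finset.mem_Ico.1 hk).1
    exact_mod_cast (hNn.trans this).trans (Nat.le_succ k)
  have hc : ‖(k : ℂ) + 1‖ = k + 1 := by exact_mod_cast Complex.norm_natCast (k + 1)
  have term : ∀ (c w : ℂ), ‖c‖ ≤ B → ‖c * w / (k + 1)‖ ≤ B / N * ‖w‖ := by
    intro c w hcB
    rw [norm_div, norm_mul, hc, mul_div_right_comm]
    gcongr
  refine (norm_sub_le _ _).trans ?_
  rw [mul_add]
  exact add_le_add (term _ _ (ha _)) (term _ _ (ha _))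

/-- Weak type `(2, 2)` maximal inequality over finitely many dyadic scales. The truncation at
`2 ^ j` is compared with `h - A_j h`, where `h` is the truncation at the largest scale `2 ^ J` and `A_j` is
the ergodic average of length `2 ^ j`; the errors form a bounded square function. -/
theorem measure_exists_lt_norm_modulatedSum_dyadic_le (hT : MeasurePreserving T μ μ) {ξ : ℂ}
    (hξ : ‖ξ‖ = 1) (f : Lp ℂ 2 μ) {t : ℝ} (ht : 0 < t) (J : ℕ) :
    μ {x | ∃ j ∈ Finset.range J, t < ‖modulatedSum (fun k => ξ ^ k) T.toEquiv f (2 ^ j) x‖}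
      ≤ ENNReal.ofReal (9000 * ‖f‖ ^ 2 / t ^ 2) := by
  set V : Lp ℂ 2 μ →L[ℂ] Lp ℂ 2 μ := (koopman hT hξ).1 with hV
  set h : Lp ℂ 2 μ := cfc (hilbertSymbol 1 (2 ^ J)) V f with hh
  set e : ℕ → Lp ℂ 2 μ := fun j => cfc (errorSymbol (2 ^ J) (2 ^ j)) V f with he
  have hhn : ‖h‖ ≤ 6 * ‖f‖ := ContinuousLinearMap.le_of_opNorm_le _
    (norm_cfc_unitary_le _ _ fun z hz => norm_hilbertSymbol_one_le_six hz _) f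
  have hcont : ∀ j, ContinuousOn (errorSymbol (2 ^ J) (2 ^ j)) (Metric.sphere 0 1) := fun j =>
    ((continuousOn_hilbertSymbol _ _).sub (continuousOn_hilbertSymbol _ _)).add
      ((continuous_averageSymbol _).continuousOn.mul (continuousOn_hilbertSymbol _ _))
  have hen : ∑ j ∈ Finset.range J, ‖e j‖ ^ 2 ≤ 900 * ‖f‖ ^ 2 :=
    sum_norm_cfc_unitary_sq_le _ _ _ hcont (fun z hz => sum_norm_errorSymbol_le hz J) f
  have hedef : ∀ j, cfc (hilbertSymbol 1 (2 ^ j)) V f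
      = e j + h - cfc (averageSymbol (2 ^ j)) V h := by
    intro j
    have c1 := fun n => continuousOn_spectrum_unitary (continuousOn_hilbertSymbol 1 n)
      (koopman hT hξ)
    have c2 := continuousOn_spectrum_unitary (continuous_averageSymbol (2 ^ j)).continuousOn
      (koopman hT hξ)
    have : cfc (errorSymbol (2 ^ J) (2 ^ j)) V
        = cfc (hilbertSymbol 1 (2 ^ j)) V - cfc (hilbertSymbol 1 (2 ^ J)) V
          + cfc (averageSymbol (2 ^ j)) V * cfc (hilbertSymbol 1 (2 ^ J)) V := by
      rw [← cfc_sub (hilbertSymbol 1 (2 ^ j)) (hilbertSymbol 1 (2 ^ J)) V (c1 _) (c1 _),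
        ← cfc_mul (averageSymbol (2 ^ j)) (hilbertSymbol 1 (2 ^ J)) V c2 (c1 _),
        ← cfc_add V (fun z => hilbertSymbol 1 (2 ^ j) z - hilbertSymbol 1 (2 ^ J) z)
          (fun z => averageSymbol (2 ^ j) z * hilbertSymbol 1 (2 ^ J) z)
          ((c1 _).sub (c1 _)) (c2.mul (c1 _))]
      rfl
    rw [he, hh]
    dsimp only
    rw [this]
    simp only [add_apply, sub_apply, mul_apply_eq_comp]
    abel
  -- Almost everywhere the three pieces dominate the truncated transform.
  have hsub : ∀ᵐ x ∂μ, (∃ j ∈ Finset.range J,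
      t < ‖modulatedSum (fun k => ξ ^ k) T.toEquiv f (2 ^ j) x‖) →
      ((∃ j ∈ Finset.range J, t / 3 < ‖e j x‖) ∨ t / 3 < ‖h x‖) ∨
        ∃ n : ℕ, t / 3 * n < ∑ k ∈ Finset.range n, ‖h (T^[k] x)‖ := by
    have h1 : ∀ᵐ x ∂μ, ∀ j : ℕ, cfc (hilbertSymbol 1 (2 ^ j)) V f x
        = modulatedSum (fun k => ξ ^ k) T.toEquiv f (2 ^ j) x := ae_all_iff.2 fun j => by
      filter_upwards [coeFn_cfc_hilbertSymbol hT hξ 1 (2 ^ j) f] with x hx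
      exact hx.trans (by simp)
    have h2 : ∀ᵐ x ∂μ, ∀ j : ℕ, cfc (averageSymbol (2 ^ j)) V h x
        = ((2 ^ j : ℕ) : ℂ)⁻¹ * ∑ i ∈ Finset.range (2 ^ j), ξ ^ i * h (T^[i] x) :=
      ae_all_iff.2 fun j => coeFn_cfc_averageSymbol hT hξ (2 ^ j) h
    have h3 : ∀ᵐ x ∂μ, ∀ j : ℕ, cfc (hilbertSymbol 1 (2 ^ j)) V f x
        = e j x + h x - cfc (averageSymbol (2 ^ j)) V h x := ae_all_iff.2 fun j => by
      rw [hedef j]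
      filter_upwards [Lp.coeFn_sub (e j + h) (cfc (averageSymbol (2 ^ j)) V h),
        Lp.coeFn_add (e j) h] with x hx1 hx2
      rw [hx1, Pi.sub_apply, hx2, Pi.add_apply]
    filter_upwards [h1, h2, h3] with x k1 k2 k3
    rintro ⟨j, hj, hlt⟩
    by_contra! hcon
    obtain ⟨⟨hc1, hc2⟩, hc3⟩ := hcon
    have hav : ‖cfc (averageSymbol (2 ^ j)) V h x‖ ≤ t / 3 := by
      rw [k2, norm_mul, norm_inv, Complex.norm_natCast, inv_mul_le_iff₀ (by positivity), mul_comm]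
      refine (norm_sum_le _ _).trans (le_trans (le_of_eq ?_) (hc3 (2 ^ j)))
      refine Finset.sum_congr rfl fun i _ => ?_
      rw [norm_mul, norm_pow, hξ, one_pow, one_mul]
    rw [← k1, k3] at hlt
    have := norm_sub_le (e j x + h x) (cfc (averageSymbol (2 ^ j)) V h x)
    have := norm_add_le (e j x) (h x)
    have := hc1 j hj
    linarith
  refine (measure_mono_ae hsub).trans ?_
  have ht3 : 0 < t / 3 := by positivity
  have b1 := measure_exists_lt_norm_le (Finset.range J) e ht3
  have b2 := measure_lt_norm_le h ht3
  have b3 := measure_exists_lt_sum_norm_le hT h ht3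
  refine (measure_union_le _ _).trans ((add_le_add ((measure_union_le _ _).trans
    (add_le_add b1 b2)) b3).trans ?_)
  rw [← ENNReal.ofReal_add (by positivity) (by positivity),
    ← ENNReal.ofReal_add (by positivity) (by positivity)]
  refine ENNReal.ofReal_le_ofReal ?_
  have hh2 : ‖h‖ ^ 2 ≤ 36 * ‖f‖ ^ 2 := by
    calc _ ≤ (6 * ‖f‖) ^ 2 := by gcongr
      _ = _ := by ring
  rw [← add_div, ← add_div, div_pow, div_div_eq_mul_div]
  refine div_le_div_of_nonneg_right ?_ (sq_nonneg t)
  linarith [sq_nonneg ‖f‖]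

/-- Cotlar's maximal inequality of weak type `(2, 2)` for the ergodic Hilbert transform. -/
theorem measure_exists_lt_norm_modulatedSum_le (hT : MeasurePreserving T μ μ) {ξ : ℂ}
    (hξ : ‖ξ‖ = 1) (f : Lp ℂ 2 μ) {t : ℝ} (ht : 0 < t) :
    μ {x | ∃ n, t < ‖modulatedSum (fun k => ξ ^ k) T.toEquiv f n x‖}
      ≤ ENNReal.ofReal (40000 * ‖f‖ ^ 2 / t ^ 2) := by
  have hb1 : ∀ k : ℤ, ‖ξ ^ k‖ ≤ 1 := fun k => by rw [norm_zpow, hξ, one_zpow]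
  set D : ℕ → Set X := fun J =>
    {x | ∃ j ∈ Finset.range J, t / 2 < ‖modulatedSum (fun k => ξ ^ k) T.toEquiv f (2 ^ j) x‖}
    with hD
  have hDmono : Monotone D := fun J K hJK x ⟨j, hj, h⟩ =>
    ⟨j, Finset.range_mono hJK hj, h⟩
  -- Truncations between `2 ^ j` and `2 ^ (j + 1)` differ from the one at `2 ^ j` by averages.
  have hsub : {x | ∃ n, t < ‖modulatedSum (fun k => ξ ^ k) T.toEquiv f n x‖}
      ⊆ ((⋃ J, D J) ∪ {x | ∃ n : ℕ, t / 12 * n < ∑ k ∈ Finset.range n, ‖f (T^[k] x)‖}) ∪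
        {x | ∃ n : ℕ, t / 12 * n < ∑ k ∈ Finset.range n, ‖f (T.symm^[k] x)‖} := by
    rintro x ⟨n, hn⟩
    by_contra hcon
    simp only [Set.mem_union, not_or, Set.mem_iUnion, not_exists] at hcon
    obtain ⟨⟨hc1, hc2⟩, hc3⟩ := hcon
    replace hc2 : ∀ n : ℕ, ∑ k ∈ Finset.range n, ‖f (T^[k] x)‖ ≤ t / 12 * n := fun n =>
      not_lt.1 fun h => hc2 ⟨n, h⟩
    replace hc3 : ∀ n : ℕ, ∑ k ∈ Finset.range n, ‖f (T.symm^[k] x)‖ ≤ t / 12 * n := fun n =>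
      not_lt.1 fun h => hc3 ⟨n, h⟩
    have hn0 : n ≠ 0 := by
      rintro rfl
      rw [modulatedSum] at hn
      simp at hn
      linarith
    set j := Nat.log 2 n with hj
    have hj1 : 2 ^ j ≤ n := Nat.pow_log_le_self 2 hn0
    have hj2 : n < 2 ^ (j + 1) := Nat.lt_pow_succ_log_self one_lt_two n
    have hdy : ‖modulatedSum (fun k => ξ ^ k) T.toEquiv f (2 ^ j) x‖ ≤ t / 2 :=
      not_lt.1 fun h => hc1 (j + 1) ⟨j, by simp, h⟩
    have hdiff := norm_modulatedSum_sub_le (T := T) (fun k => ξ ^ k) hb1 f (N := 2 ^ j)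
      (by positivity) le_rfl hj1 x
    have hsum : ∑ k ∈ Finset.Ico (2 ^ j) n, (‖f (T^[k + 1] x)‖ + ‖f (T.symm^[k + 1] x)‖)
        ≤ ∑ k ∈ Finset.range (2 ^ (j + 1) + 2 ^ j), ‖f (T^[k] x)‖
          + ∑ k ∈ Finset.range (2 ^ (j + 1) + 2 ^ j), ‖f (T.symm^[k] x)‖ := by
      rw [Finset.sum_add_distrib]
      have gen : ∀ F : ℕ → ℝ, (∀ k, 0 ≤ F k) → ∑ k ∈ Finset.Ico (2 ^ j) n, F (k + 1)
          ≤ ∑ k ∈ Finset.range (2 ^ (j + 1) + 2 ^ j), F k := by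
        intro F hF
        rw [Finset.sum_Ico_add' F]
        refine Finset.sum_le_sum_of_subset_of_nonneg (fun k hk => ?_) fun k _ _ => hF k
        rw [Finset.mem_Ico] at hk
        rw [Finset.mem_range]
        omega
      exact add_le_add (gen (fun k => ‖f (T^[k] x)‖) fun k => norm_nonneg _)
        (gen (fun k => ‖f (T.symm^[k] x)‖) fun k => norm_nonneg _)
    have h2 := hc2 (2 ^ (j + 1) + 2 ^ j)
    have h3 := hc3 (2 ^ (j + 1) + 2 ^ j)
    have hpow : ((2 ^ (j + 1) + 2 ^ j : ℕ) : ℝ) = 3 * 2 ^ j := by push_cast; ring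
    rw [hpow] at h2 h3
    have hfin : ‖modulatedSum (fun k => ξ ^ k) T.toEquiv f n x
        - modulatedSum (fun k => ξ ^ k) T.toEquiv f (2 ^ j) x‖ ≤ t / 2 := by
      refine hdiff.trans ?_
      rw [one_div, inv_mul_le_iff₀ (by positivity)]
      push_cast
      linarith
    have := norm_sub_norm_le (modulatedSum (fun k => ξ ^ k) T.toEquiv f n x)
      (modulatedSum (fun k => ξ ^ k) T.toEquiv f (2 ^ j) x)
    change t < ‖_‖ at hn
    linarith
  have hDm : μ (⋃ J, D J) ≤ ENNReal.ofReal (9000 * ‖f‖ ^ 2 / (t / 2) ^ 2) := by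
    rw [hDmono.measure_iUnion]
    exact iSup_le fun J =>
      measure_exists_lt_norm_modulatedSum_dyadic_le hT hξ f (by positivity) J
  have ht12 : 0 < t / 12 := by positivity
  refine (measure_mono hsub).trans ((measure_union_le _ _).trans ((add_le_add
    ((measure_union_le _ _).trans (add_le_add hDm (measure_exists_lt_sum_norm_le hT f ht12)))
    (measure_exists_lt_sum_norm_le (hT.symm T) f ht12)).trans ?_))
  rw [← ENNReal.ofReal_add (by positivity) (by positivity),
    ← ENNReal.ofReal_add (by positivity) (by positivity)]
  refine ENNReal.ofReal_le_ofReal ?_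
  rw [div_pow, div_pow, div_div_eq_mul_div, div_div_eq_mul_div, ← add_div, ← add_div]
  refine div_le_div_of_nonneg_right ?_ (sq_nonneg t)
  linarith [sq_nonneg ‖f‖]

/-- On invariant functions the terms with indices `k` and `-k` cancel. -/
theorem cfc_hilbertSymbol_apply_of_fixed (hT : MeasurePreserving T μ μ) {ξ : ℂ} (hξ : ‖ξ‖ = 1)
    (f : Lp ℂ 2 μ) (hf : (koopman hT hξ : Lp ℂ 2 μ →L[ℂ] Lp ℂ 2 μ) f = f) (n : ℕ) :
    cfc (hilbertSymbol 1 n) (koopman hT hξ : Lp ℂ 2 μ →L[ℂ] Lp ℂ 2 μ) f = 0 := by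
  have hs : hilbertSymbol 1 n = fun z => ∑ k ∈ (Finset.Icc (-(n : ℤ)) (n : ℤ)).erase 0,
      (1 / (k : ℂ)) * z ^ k := by
    ext z
    exact Finset.sum_congr rfl fun k _ => by simp only [Pi.one_apply]; ring
  have hpow : ∀ k : ℤ, ((koopman hT hξ ^ k : unitary (Lp ℂ 2 μ →L[ℂ] Lp ℂ 2 μ)) :
      Lp ℂ 2 μ →L[ℂ] Lp ℂ 2 μ) f = f := by
    set V := koopman hT hξ
    have mul : ∀ U W : unitary (Lp ℂ 2 μ →L[ℂ] Lp ℂ 2 μ),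
        ((U * W : unitary (Lp ℂ 2 μ →L[ℂ] Lp ℂ 2 μ)) : Lp ℂ 2 μ →L[ℂ] Lp ℂ 2 μ) f
        = (U : Lp ℂ 2 μ →L[ℂ] Lp ℂ 2 μ) ((W : Lp ℂ 2 μ →L[ℂ] Lp ℂ 2 μ) f) := fun U W => rfl
    intro k
    induction k using Int.induction_on with
    | zero => simp
    | succ k ih => rw [zpow_add_one, mul, hf, ih]
    | pred k ih =>
      have h1 : ((V ^ (-(k : ℤ) - 1) * V : unitary (Lp ℂ 2 μ →L[ℂ] Lp ℂ 2 μ)) :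
        Lp ℂ 2 μ →L[ℂ] Lp ℂ 2 μ) f = f := by rw [← zpow_add_one, sub_add_cancel, ih]
      rwa [mul, hf] at h1
  rw [hs, cfc_unitary_sum_zpow, sum_apply]
  simp only [smul_apply, hpow]
  rw [← Finset.sum_smul, sum_erase_zero_eq]
  rw [Finset.sum_eq_zero fun k _ => by push_cast; rw [div_neg, add_neg_cancel], zero_smul]

/-- On coboundaries `h - V h` the truncated Hilbert transforms converge in norm at the rate `1 / n`,
hence almost everywhere. -/
theorem ae_exists_tendsto_of_coboundary (hT : MeasurePreserving T μ μ) {ξ : ℂ} (hξ : ‖ξ‖ = 1)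
    (h : Lp ℂ 2 μ) :
    ∀ᵐ x ∂μ, ∃ l : ℂ, Tendsto (fun n => cfc (hilbertSymbol 1 n)
      (koopman hT hξ : Lp ℂ 2 μ →L[ℂ] Lp ℂ 2 μ)
      ((koopman hT hξ : Lp ℂ 2 μ →L[ℂ] Lp ℂ 2 μ) h - h) x) atTop (𝓝 l) := by
  set V : Lp ℂ 2 μ →L[ℂ] Lp ℂ 2 μ := (koopman hT hξ).1 with hV
  have hsum : Summable fun n : ℕ => 16 * ‖h‖ ^ 2 * (1 / ((n : ℝ) + 1) ^ 2) := by
    refine Summable.mul_left _ ?_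
    have := (summable_nat_add_iff 1).2 (Real.summable_one_div_nat_pow.2 one_lt_two)
    simpa using this
  refine ae_exists_tendsto_of_norm_sub_sq_le _ _ hsum fun n L hnL => ?_
  have c1 := fun n => continuousOn_spectrum_unitary (continuousOn_hilbertSymbol 1 n)
    (koopman hT hξ)
  have c2 : ContinuousOn (fun z : ℂ => z) (spectrum ℂ V) := continuousOn_id
  have c3 : ContinuousOn (fun _ : ℂ => (1 : ℂ)) (spectrum ℂ V) := continuousOn_const
  have hnorm : IsStarNormal V := by rw [hV]; infer_instance
  have key : cfc (hilbertSymbol 1 L) V (V h - h) - cfc (hilbertSymbol 1 n) V (V h - h)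
      = cfc (fun z => (hilbertSymbol 1 L z - hilbertSymbol 1 n z) * (z - 1)) V h := by
    rw [cfc_mul (fun z => hilbertSymbol 1 L z - hilbertSymbol 1 n z) (fun z => z - 1) V
        ((c1 _).sub (c1 _)) (c2.sub c3),
      cfc_sub (hilbertSymbol 1 L) (hilbertSymbol 1 n) V (c1 _) (c1 _),
      cfc_sub (fun z => z) (fun _ => 1) V c2 c3, cfc_id' ℂ V, cfc_const_one ℂ V]
    rfl
  have hle : ‖cfc (fun z => (hilbertSymbol 1 L z - hilbertSymbol 1 n z) * (z - 1)) V‖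
      ≤ 4 / (n + 1) := norm_cfc_unitary_le _ _ fun z hz => by
    rw [norm_mul, norm_sub_rev z 1]
    exact norm_hilbertSymbol_one_sub_mul_le hz hnL
  rw [key]
  calc _ ≤ (4 / ((n : ℝ) + 1) * ‖h‖) ^ 2 := by
        gcongr
        exact ContinuousLinearMap.le_of_opNorm_le _ hle h
    _ = _ := by rw [mul_pow, div_pow]; ring

/-- Invariant functions and coboundaries of a unitary operator span a dense subspace. -/
theorem exists_fixed_add_mem_closure_range {E : Type*} [NormedAddCommGroup E]
    [InnerProductSpace ℂ E] [CompleteSpace E] (V : unitary (E →L[ℂ] E)) (f : E) :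
    ∃ y g, (V : E →L[ℂ] E) y = y ∧ g ∈ closure (Set.range fun h => (V : E →L[ℂ] E) h - h) ∧
      f = y + g := by
  set R : Submodule ℂ E := ((V : E →L[ℂ] E) - 1).range.topologicalClosure with hR
  have : CompleteSpace R := (Submodule.isClosed_topologicalClosure _).completeSpace_coe
  obtain ⟨g, hg, y, hy, rfl⟩ := R.exists_add_mem_mem_orthogonal f
  refine ⟨y, g, ?_, ?_, add_comm _ _⟩
  · -- A vector orthogonal to the range of `V - 1` is fixed by the adjoint, which is the inverse.
    have h1 : ∀ h, inner ℂ ((V : E →L[ℂ] E) h) y = inner ℂ h y := by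
      intro h
      have : inner ℂ ((V : E →L[ℂ] E) h - h) y = 0 := hy _
        (Submodule.le_topologicalClosure _ ⟨h, by simp⟩)
      rwa [inner_sub_left, sub_eq_zero] at this
    refine eq_of_norm_le_re_inner_eq_norm_sq (𝕜 := ℂ) (Unitary.norm_map V y).le ?_
    rw [h1, inner_self_eq_norm_sq]
  · have : (Set.range fun h => (V : E →L[ℂ] E) h - h)
        = (((V : E →L[ℂ] E) - 1).range : Set E) := by ext w; simp
    rw [this, ← Submodule.topologicalClosure_coe]
    exact hg

/-- Characters are good weights in `L²`: the maximal inequality extends the convergence from the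
dense subspace spanned by invariant functions and coboundaries. -/
theorem ae_exists_tendsto_modulatedSum_character (hT : MeasurePreserving T μ μ) {ξ : ℂ}
    (hξ : ‖ξ‖ = 1) (f : Lp ℂ 2 μ) :
    ∀ᵐ x ∂μ, ∃ l : ℂ,
      Tendsto (fun n => modulatedSum (fun k => ξ ^ k) T.toEquiv f n x) atTop (𝓝 l) := by
  set V : Lp ℂ 2 μ →L[ℂ] Lp ℂ 2 μ := (koopman hT hξ).1 with hV
  have hcoe : ∀ f : Lp ℂ 2 μ, ∀ᵐ x ∂μ, ∀ n : ℕ, cfc (hilbertSymbol 1 n) V f x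
      = modulatedSum (fun k => ξ ^ k) T.toEquiv f n x := fun f => ae_all_iff.2 fun n => by
    filter_upwards [coeFn_cfc_hilbertSymbol hT hξ 1 n f] with x hx
    exact hx.trans (by simp)
  have hclosed := isClosed_setOf_ae_exists_tendsto (fun n => cfc (hilbertSymbol 1 n) V) 40000
    (fun f t ht => by
      refine le_trans (measure_mono_ae ?_) (measure_exists_lt_norm_modulatedSum_le hT hξ f ht)
      filter_upwards [hcoe f] with x hx
      rintro ⟨n, hn⟩
      exact ⟨n, by rwa [← hx]⟩)
  obtain ⟨y, g, hy, hg, rfl⟩ := exists_fixed_add_mem_closure_range (koopman hT hξ) f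
  have hg' : ∀ᵐ x ∂μ, ∃ l : ℂ, Tendsto (fun n => cfc (hilbertSymbol 1 n) V g x) atTop (𝓝 l) := by
    have := hclosed.closure_subset_iff.2 (Set.range_subset_iff.2 fun h =>
      ae_exists_tendsto_of_coboundary hT hξ h)
    exact this hg
  filter_upwards [hcoe (y + g), hg'] with x hx ⟨l, hl⟩
  refine ⟨l, hl.congr fun n => ?_⟩
  rw [← hx, map_add, cfc_hilbertSymbol_apply_of_fixed hT hξ y hy, zero_add]

end Character

/-! ### Weights with small exponential sums -/

/-- The bound defining `ClassA α` is strongest for small `α`: for `α ≤ 2` it implies the one for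
`α = 2`, since `log n ≤ n`. -/
theorem norm_le_of_mem_classA {α : ℝ} (hα' : α ≤ 2) {b : ℤ → ℂ}
    (hb : b ∈ ClassA α) :
    ∃ C : ℝ, 0 ≤ C ∧ ∀ n : ℕ, 2 ≤ n → ∀ z : ℂ, ‖z‖ = 1 →
      ‖∑ k ∈ Finset.Icc (-(n : ℤ)) (n : ℤ), b k * z ^ k‖ ≤ C * (n / Real.log n ^ 2) := by
  obtain ⟨C, hC⟩ := hb
  refine ⟨max C 0, le_max_right _ _, fun n hn z hz => ?_⟩
  have hn1 : (1 : ℝ) < n := by exact_mod_cast hn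
  have hn0 : (0 : ℝ) < n := by linarith
  have hlog : 0 < Real.log n := Real.log_pos hn1
  have h := hC n (by omega) z hz
  set D := ‖∑ k ∈ Finset.Icc (-(n : ℤ)) (n : ℤ), b k * z ^ k‖ with hD
  have h1 : D ≤ max C 0 * ((n : ℝ) ^ (α - 1) / Real.log n ^ α) := by
    have hpos : 0 < Real.log n ^ α / (n : ℝ) ^ (α - 1) := by positivity
    rw [mul_comm, ← le_div_iff₀ hpos] at h
    refine h.trans ?_
    rw [div_div_eq_mul_div, mul_div_assoc]
    gcongr
    exact le_max_left _ _
  refine h1.trans (mul_le_mul_of_nonneg_left ?_ (le_max_right _ _))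
  have h2 : Real.log n ^ (2 - α) ≤ (n : ℝ) ^ (2 - α) :=
    Real.rpow_le_rpow hlog.le (by linarith [Real.log_le_sub_one_of_pos hn0]) (by linarith)
  rw [div_le_div_iff₀ (by positivity) (by positivity)]
  have e1 : Real.log n ^ 2 = Real.log n ^ (2 - α) * Real.log n ^ α := by
    rw [← Real.rpow_add hlog]; simp
  have e2 : (n : ℝ) = (n : ℝ) ^ (α - 1) * (n : ℝ) ^ (2 - α) := by
    rw [← Real.rpow_add hn0]; ring_nf; simp
  calc (n : ℝ) ^ (α - 1) * Real.log n ^ 2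
      = (n : ℝ) ^ (α - 1) * Real.log n ^ (2 - α) * Real.log n ^ α := by rw [e1]; ring
    _ ≤ (n : ℝ) ^ (α - 1) * (n : ℝ) ^ (2 - α) * Real.log n ^ α := by gcongr
    _ = n * Real.log n ^ α := by rw [← e2]

/-- For a sequence in `ClassA α` the blocks of the Hilbert symbol inside the `j`-th dyadic interval
are uniformly of size `1 / j ^ 2`. -/
theorem norm_hilbertSymbol_sub_le_of_mem_classA {α : ℝ} (hα' : α ≤ 2)
    {b : ℤ → ℂ} (hb : b ∈ ClassA α) :
    ∃ K : ℝ, 0 ≤ K ∧ ∀ j m : ℕ, 1 ≤ j → 2 ^ j ≤ m → m ≤ 2 ^ (j + 1) → ∀ z : ℂ, ‖z‖ = 1 →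
      ‖hilbertSymbol b m z - hilbertSymbol b (2 ^ j) z‖ ≤ K / (j : ℝ) ^ 2 := by
  obtain ⟨C, hC0, hC⟩ := norm_le_of_mem_classA hα' hb
  refine ⟨80 * C, by positivity, fun j m hj h1 h2 z hz => ?_⟩
  set n := 2 ^ j with hn
  have hn2 : 2 ≤ n := by
    calc 2 = 2 ^ 1 := rfl
      _ ≤ _ := Nat.pow_le_pow_right two_pos hj
  have hn1 : (1 : ℝ) < n := by exact_mod_cast hn2
  have hlog : 0 < Real.log n := Real.log_pos hn1
  have hm : m ≤ 2 * n := by rw [hn]; rwa [pow_succ'] at h2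
  have hD := norm_hilbertSymbol_sub_le_of_partialSums b h1 hm (C * (2 * n / Real.log n ^ 2))
    (fun k hk1 hk2 z hz => by
      refine (hC k (hn2.trans hk1) z hz).trans ?_
      have c1 : (n : ℝ) ≤ k := by exact_mod_cast hk1
      have c2 : (k : ℝ) ≤ 2 * n := by exact_mod_cast hk2.trans hm
      gcongr) z hz
  refine hD.trans ?_
  have hlogj : (j : ℝ) / 2 ≤ Real.log n := by
    rw [hn]; push_cast
    rw [Real.log_pow]
    have := Real.log_two_gt_d9
    have hj0 : (0 : ℝ) ≤ j := j.cast_nonneg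
    nlinarith
  have hj0 : (0 : ℝ) < j := by exact_mod_cast hj
  calc 10 * (C * (2 * n / Real.log n ^ 2)) / (n + 1)
      = 20 * C / Real.log n ^ 2 * (n / (n + 1)) := by ring
    _ ≤ 20 * C / Real.log n ^ 2 * 1 := by
        gcongr
        rw [div_le_one (by positivity)]
        linarith
    _ ≤ 20 * C / ((j : ℝ) / 2) ^ 2 * 1 := by gcongr
    _ = _ := by field_simp; ring

section

variable {X : Type u} [MeasurableSpace X] {μ : Measure X} {T : X ≃ᵐ X}

theorem ae_tendsto_zero_of_lintegral_le (G : ℕ → X → ℝ) (hG0 : ∀ n x, 0 ≤ G n x)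
    (hG : ∀ n, Measurable (G n)) (ρ : ℕ → ℝ) (hρ : Summable ρ)
    (h : ∀ n, ∫⁻ x, ENNReal.ofReal (G n x) ∂μ ≤ ENNReal.ofReal (ρ n)) :
    ∀ᵐ x ∂μ, Tendsto (fun n => G n x) atTop (𝓝 0) := by
  have hsum : ∑' n, ∫⁻ x, ENNReal.ofReal (G n x) ∂μ ≠ ⊤ :=
    ne_top_of_le_ne_top hρ.tsum_ofReal_ne_top (ENNReal.tsum_le_tsum h)
  filter_upwards [ae_tendsto_zero_of_tsum_lintegral_ne_top _
    (fun n => (hG n).ennreal_ofReal) hsum] with x hx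
  have := (ENNReal.tendsto_toReal ENNReal.zero_ne_top).comp hx
  simpa [Function.comp_def, ENNReal.toReal_ofReal (hG0 _ x)] using this

theorem lintegral_ofReal_norm_sq (g : Lp ℂ 2 μ) :
    ∫⁻ x, ENNReal.ofReal (‖g x‖ ^ 2) ∂μ = ENNReal.ofReal (‖g‖ ^ 2) := by
  rw [← lintegral_enorm_sq]
  refine lintegral_congr fun x => ?_
  rw [ENNReal.ofReal_pow (norm_nonneg _), ofReal_norm]

theorem measurable_norm_sq (g : Lp ℂ 2 μ) : Measurable fun x => ‖g x‖ ^ 2 :=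
  (Lp.stronglyMeasurable g).measurable.norm.pow_const 2

theorem lintegral_ofReal_sum {ι : Type*} (s : Finset ι) (G : ι → X → ℝ)
    (hG0 : ∀ i x, 0 ≤ G i x) (hG : ∀ i, Measurable (G i)) :
    ∫⁻ x, ENNReal.ofReal (∑ i ∈ s, G i x) ∂μ = ∑ i ∈ s, ∫⁻ x, ENNReal.ofReal (G i x) ∂μ := by
  rw [← lintegral_finsetSum _ fun i _ => (hG i).ennreal_ofReal]
  exact lintegral_congr fun x => ENNReal.ofReal_sum_of_nonneg fun i _ => hG0 i x

theorem summable_const_div_sq (c : ℝ) : Summable fun j : ℕ => c / (j : ℝ) ^ 2 := by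
  simpa [div_eq_mul_inv] using (Real.summable_nat_pow_inv.2 one_lt_two).mul_left c

/-- The sums of `|f| ^ 2` along the `j`-th dyadic block of the orbit, divided by the length of the
block and by `j ^ 2`, tend to zero almost everywhere. -/
theorem ae_tendsto_dyadic_sum_norm_sq (hT : MeasurePreserving T μ μ) (f : Lp ℂ 2 μ) :
    ∀ᵐ x ∂μ, Tendsto (fun j : ℕ => 1 / (2 ^ j * (j : ℝ) ^ 2) *
      ∑ k ∈ Finset.Ico (2 ^ j) (2 ^ (j + 1)), (‖f (T^[k + 1] x)‖ ^ 2 + ‖f (T.symm^[k + 1] x)‖ ^ 2))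
      atTop (𝓝 0) := by
  have m1 : ∀ k, Measurable fun x => ‖f (T^[k] x)‖ ^ 2 := fun k =>
    (measurable_norm_sq f).comp (hT.measurable.iterate k)
  have m2 : ∀ k, Measurable fun x => ‖f (T.symm^[k] x)‖ ^ 2 := fun k =>
    (measurable_norm_sq f).comp ((hT.symm T).measurable.iterate k)
  have m3 : ∀ k, Measurable fun x => ‖f (T^[k] x)‖ ^ 2 + ‖f (T.symm^[k] x)‖ ^ 2 := fun k =>
    (m1 k).add (m2 k)
  refine ae_tendsto_zero_of_lintegral_le _ (fun n x => by positivity)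
    (fun j => (Finset.measurable_sum _ fun k _ => m3 (k + 1)).const_mul _)
    _ (summable_const_div_sq (2 * ‖f‖ ^ 2)) fun j => ?_
  have i1 : ∀ k, ∫⁻ x, ENNReal.ofReal (‖f (T^[k] x)‖ ^ 2) ∂μ = ENNReal.ofReal (‖f‖ ^ 2) :=
    fun k => by
    rw [← lintegral_ofReal_norm_sq]
    exact (hT.iterate k).lintegral_comp (measurable_norm_sq f).ennreal_ofReal
  have i2 : ∀ k, ∫⁻ x, ENNReal.ofReal (‖f (T.symm^[k] x)‖ ^ 2) ∂μ = ENNReal.ofReal (‖f‖ ^ 2) :=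
    fun k => by
    rw [← lintegral_ofReal_norm_sq]
    exact ((hT.symm T).iterate k).lintegral_comp (measurable_norm_sq f).ennreal_ofReal
  have i3 : ∀ k, ∫⁻ x, ENNReal.ofReal (‖f (T^[k] x)‖ ^ 2 + ‖f (T.symm^[k] x)‖ ^ 2) ∂μ
      = ENNReal.ofReal (2 * ‖f‖ ^ 2) := fun k => by
    simp_rw [ENNReal.ofReal_add (sq_nonneg _) (sq_nonneg _)]
    rw [lintegral_add_left (m1 k).ennreal_ofReal, i1, i2, two_mul,
      ENNReal.ofReal_add (sq_nonneg _) (sq_nonneg _)]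
  have hc : 0 ≤ 1 / (2 ^ j * (j : ℝ) ^ 2) := by positivity
  simp_rw [ENNReal.ofReal_mul hc]
  rw [lintegral_const_mul _ (Finset.measurable_sum _ fun k _ => m3 (k + 1)).ennreal_ofReal,
    lintegral_ofReal_sum _ _ (fun k x => by positivity) fun k => m3 (k + 1)]
  simp_rw [i3]
  rw [Finset.sum_const, Nat.card_Ico, nsmul_eq_mul, ← ENNReal.ofReal_natCast,
    ← ENNReal.ofReal_mul (by positivity), ← ENNReal.ofReal_mul hc]
  refine ENNReal.ofReal_le_ofReal (le_of_eq ?_)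
  have : ((2 ^ (j + 1) - 2 ^ j : ℕ) : ℝ) = 2 ^ j := by
    rw [pow_succ, Nat.mul_two, Nat.add_sub_cancel]; push_cast; rfl
  rw [this, one_div, mul_inv]
  field_simp

/-- The `i`-th of about `j ^ 2` equally spaced points of the dyadic interval from `2 ^ j` to
`2 ^ (j + 1)`. -/
def gridPoint (j i : ℕ) : ℕ := min (2 ^ j + i * (2 ^ j / j ^ 2 + 1)) (2 ^ (j + 1))

/-- Each point of a dyadic interval lies at most `2 ^ j / j ^ 2` above one of the `j ^ 2`
grid points. -/
theorem exists_gridPoint_le {j n : ℕ} (hj : 1 ≤ j) (h1 : 2 ^ j ≤ n) (h2 : n < 2 ^ (j + 1)) :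
    ∃ i < j ^ 2, 2 ^ j ≤ gridPoint j i ∧ gridPoint j i ≤ n ∧ n - gridPoint j i ≤ 2 ^ j / j ^ 2 := by
  set s := 2 ^ j / j ^ 2 + 1 with hs
  have hj2 : 0 < j ^ 2 := by positivity
  have hlt : 2 ^ j < j ^ 2 * s := by
    rw [hs]; exact Nat.lt_mul_div_succ _ hj2
  have hpow : 2 ^ (j + 1) = 2 ^ j + 2 ^ j := by rw [pow_succ, Nat.mul_two]
  have hs0 : 0 < s := Nat.succ_pos _
  have hdm := Nat.div_add_mod (n - 2 ^ j) s
  have hmod := Nat.mod_lt (n - 2 ^ j) hs0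
  rw [mul_comm] at hdm
  refine ⟨(n - 2 ^ j) / s, ?_, ?_⟩
  · rw [Nat.div_lt_iff_lt_mul hs0]
    omega
  · have : gridPoint j ((n - 2 ^ j) / s) = 2 ^ j + (n - 2 ^ j) / s * s := by
      rw [gridPoint, ← hs]
      exact min_eq_left (by omega)
    rw [this]
    omega

theorem le_gridPoint (j i : ℕ) : 2 ^ j ≤ gridPoint j i :=
  le_min (Nat.le_add_right _ _) (Nat.pow_le_pow_right two_pos (Nat.le_succ j))

/-- Inside the `j`-th dyadic interval the truncated transforms are controlled by their values at the
grid points, up to the contribution of the short stretches between them. -/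
theorem norm_modulatedSum_sub_dyadic_sq_le (b : ℤ → ℂ) {B : ℝ} (hB : ∀ k, ‖b k‖ ≤ B) (f : X → ℂ)
    {j n : ℕ} (hj : 1 ≤ j) (h1 : 2 ^ j ≤ n) (h2 : n < 2 ^ (j + 1)) (x : X) :
    ‖modulatedSum b T.toEquiv f n x - modulatedSum b T.toEquiv f (2 ^ j) x‖ ^ 2
      ≤ 2 * ∑ i ∈ Finset.range (j ^ 2), ‖modulatedSum b T.toEquiv f (gridPoint j i) x
            - modulatedSum b T.toEquiv f (2 ^ j) x‖ ^ 2
        + 4 * B ^ 2 * (1 / (2 ^ j * (j : ℝ) ^ 2) * ∑ k ∈ Finset.Ico (2 ^ j) (2 ^ (j + 1)),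
            (‖f (T^[k + 1] x)‖ ^ 2 + ‖f (T.symm^[k + 1] x)‖ ^ 2)) := by
  obtain ⟨i, hi, hp1, hp2, hp3⟩ := exists_gridPoint_le hj h1 h2
  set p := gridPoint j i with hp
  set S := fun n => modulatedSum b T.toEquiv f n x with hS
  set Q := ∑ k ∈ Finset.Ico (2 ^ j) (2 ^ (j + 1)),
    (‖f (T^[k + 1] x)‖ ^ 2 + ‖f (T.symm^[k + 1] x)‖ ^ 2) with hQ
  have hj0 : (0 : ℝ) < j := by exact_mod_cast hj
  have hgrid : ‖S p - S (2 ^ j)‖ ^ 2 ≤ ∑ i ∈ Finset.range (j ^ 2),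
      ‖S (gridPoint j i) - S (2 ^ j)‖ ^ 2 :=
    Finset.single_le_sum (f := fun i => ‖S (gridPoint j i) - S (2 ^ j)‖ ^ 2)
      (fun i _ => sq_nonneg _) (Finset.mem_range.2 hi)
  have hfill : ‖S n - S p‖ ^ 2 ≤ 2 * B ^ 2 * (1 / (2 ^ j * (j : ℝ) ^ 2) * Q) := by
    have c1 := norm_modulatedSum_sub_le (T := T) b hB f (N := 2 ^ j) (by positivity) hp1 hp2 x
    have c2 := sq_sum_le_card_mul_sum_sq (s := Finset.Ico p n)
      (f := fun k => ‖f (T^[k + 1] x)‖ + ‖f (T.symm^[k + 1] x)‖)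
    rw [Nat.card_Ico] at c2
    have c3 : ∑ k ∈ Finset.Ico p n, (‖f (T^[k + 1] x)‖ + ‖f (T.symm^[k + 1] x)‖) ^ 2 ≤ 2 * Q := by
      rw [hQ, Finset.mul_sum]
      refine (Finset.sum_le_sum fun k _ => add_sq_le).trans
        (Finset.sum_le_sum_of_subset_of_nonneg (Finset.Ico_subset_Ico hp1 h2.le)
          fun k _ _ => by positivity)
    have c4 : ((n - p : ℕ) : ℝ) ≤ 2 ^ j / (j : ℝ) ^ 2 := by
      refine (Nat.cast_le.2 hp3).trans ?_
      exact_mod_cast Nat.cast_div_le (α := ℝ) (m := 2 ^ j) (n := j ^ 2)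
    calc ‖S n - S p‖ ^ 2 ≤ (B / (2 ^ j : ℕ) *
          ∑ k ∈ Finset.Ico p n, (‖f (T^[k + 1] x)‖ + ‖f (T.symm^[k + 1] x)‖)) ^ 2 :=
          pow_le_pow_left₀ (norm_nonneg _) c1 2
      _ = (B / 2 ^ j) ^ 2 *
          (∑ k ∈ Finset.Ico p n, (‖f (T^[k + 1] x)‖ + ‖f (T.symm^[k + 1] x)‖)) ^ 2 := by
          rw [mul_pow]; push_cast; rfl
      _ ≤ (B / 2 ^ j) ^ 2 * (2 ^ j / (j : ℝ) ^ 2 * (2 * Q)) := by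
          gcongr
          exact c2.trans (mul_le_mul c4 c3 (by positivity) (by positivity))
      _ = _ := by field_simp
  have htri : ‖S n - S (2 ^ j)‖ ≤ ‖S n - S p‖ + ‖S p - S (2 ^ j)‖ :=
    norm_sub_le_norm_sub_add_norm_sub _ _ _
  calc ‖S n - S (2 ^ j)‖ ^ 2 ≤ (‖S n - S p‖ + ‖S p - S (2 ^ j)‖) ^ 2 :=
        pow_le_pow_left₀ (norm_nonneg _) htri 2
    _ ≤ 2 * (‖S n - S p‖ ^ 2 + ‖S p - S (2 ^ j)‖ ^ 2) := add_sq_le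
    _ ≤ _ := by linarith

theorem norm_cfc_hilbertSymbol_sub_le {E : Type*} [NormedAddCommGroup E] [InnerProductSpace ℂ E]
    [CompleteSpace E] (V : unitary (E →L[ℂ] E)) (b : ℤ → ℂ) (n m : ℕ) {C : ℝ}
    (hC : ∀ z : ℂ, ‖z‖ = 1 → ‖hilbertSymbol b m z - hilbertSymbol b n z‖ ≤ C) (f : E) :
    ‖cfc (hilbertSymbol b m) V.1 f - cfc (hilbertSymbol b n) V.1 f‖ ≤ C * ‖f‖ := by
  have c := fun n => continuousOn_spectrum_unitary (continuousOn_hilbertSymbol b n) V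
  rw [← sub_apply, ← cfc_sub _ _ _ (c m) (c n)]
  exact ContinuousLinearMap.le_of_opNorm_le _ (norm_cfc_unitary_le V _ hC) f

/-- Bounded weights whose Hilbert symbols vary by at most `K / j ^ 2` inside the `j`-th dyadic
interval are good in `L²`. -/
theorem ae_exists_tendsto_modulatedSum_of_dyadic (hT : MeasurePreserving T μ μ) (b : ℤ → ℂ) {B : ℝ}
    (hB : ∀ k, ‖b k‖ ≤ B) {K : ℝ} (hK0 : 0 ≤ K)
    (hK : ∀ j m : ℕ, 1 ≤ j → 2 ^ j ≤ m → m ≤ 2 ^ (j + 1) → ∀ z : ℂ, ‖z‖ = 1 →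
      ‖hilbertSymbol b m z - hilbertSymbol b (2 ^ j) z‖ ≤ K / (j : ℝ) ^ 2)
    (f : Lp ℂ 2 μ) :
    ∀ᵐ x ∂μ, ∃ l : ℂ, Tendsto (fun n => modulatedSum b T.toEquiv f n x) atTop (𝓝 l) := by
  set V := koopman hT norm_one with hV
  have hop : ∀ j m : ℕ, 1 ≤ j → 2 ^ j ≤ m → m ≤ 2 ^ (j + 1) →
      ‖cfc (hilbertSymbol b m) V.1 f - cfc (hilbertSymbol b (2 ^ j)) V.1 f‖
        ≤ K / (j : ℝ) ^ 2 * ‖f‖ := fun j m hj h1 h2 =>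
    norm_cfc_hilbertSymbol_sub_le V b _ _ (hK j m hj h1 h2) f
  -- Along the powers of two the distances to the limit are of order `1 / j`.
  have hdy : ∀ᵐ x ∂μ, ∃ l : ℂ,
      Tendsto (fun j => cfc (hilbertSymbol b (2 ^ (j + 1))) V.1 f x) atTop (𝓝 l) := by
    have hsum : Summable fun j : ℕ => (2 * K * ‖f‖) ^ 2 * (1 / ((j : ℝ) + 1) ^ 2) := by
      refine Summable.mul_left _ ?_
      have := (summable_nat_add_iff 1).2 (Real.summable_one_div_nat_pow.2 one_lt_two)
      simpa using this
    refine ae_exists_tendsto_of_norm_sub_sq_le _ _ hsum fun j L hjL => ?_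
    have tele : ‖cfc (hilbertSymbol b (2 ^ (L + 1))) V.1 f
        - cfc (hilbertSymbol b (2 ^ (j + 1))) V.1 f‖
        ≤ 2 * K * ‖f‖ * (1 / ((j : ℝ) + 1) - 1 / ((L : ℝ) + 1)) := by
      induction L, hjL using Nat.le_induction with
      | base => simp
      | succ L hL ih =>
        have h1 := hop (L + 1) (2 ^ (L + 1 + 1)) (by omega)
          (Nat.pow_le_pow_right two_pos (by omega)) le_rfl
        push_cast at h1
        have h2 : 1 / ((L : ℝ) + 1) ^ 2 ≤ 2 * (1 / ((L : ℝ) + 1) - 1 / ((L : ℝ) + 1 + 1)) := by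
          have : (0 : ℝ) ≤ L := L.cast_nonneg
          rw [div_sub_div _ _ (by positivity) (by positivity), mul_div_assoc',
            div_le_div_iff₀ (by positivity) (by positivity)]
          nlinarith
        refine (norm_sub_le_norm_sub_add_norm_sub _ (cfc (hilbertSymbol b (2 ^ (L + 1))) V.1 f)
          _).trans ((add_le_add h1 ih).trans ?_)
        have h3 := mul_le_mul_of_nonneg_left h2 (mul_nonneg hK0 (norm_nonneg f))
        push_cast
        calc _ = K * ‖f‖ * (1 / ((L : ℝ) + 1) ^ 2)
              + 2 * K * ‖f‖ * (1 / ((j : ℝ) + 1) - 1 / ((L : ℝ) + 1)) := by ring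
          _ ≤ _ := by linarith
    calc _ ≤ (2 * K * ‖f‖ * (1 / ((j : ℝ) + 1))) ^ 2 := by
          refine pow_le_pow_left₀ (norm_nonneg _) (tele.trans ?_) 2
          gcongr
          have : 0 ≤ 1 / ((L : ℝ) + 1) := by positivity
          linarith
      _ = _ := by rw [mul_pow, one_div, one_div, inv_pow]
  -- The oscillation over the grid points of a dyadic interval tends to zero.
  have hgrid : ∀ᵐ x ∂μ, Tendsto (fun j : ℕ => ∑ i ∈ Finset.range (j ^ 2),
      ‖(cfc (hilbertSymbol b (gridPoint j i)) V.1 f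
        - cfc (hilbertSymbol b (2 ^ j)) V.1 f : Lp ℂ 2 μ) x‖ ^ 2) atTop (𝓝 0) := by
    refine ae_tendsto_zero_of_lintegral_le _ (fun j x => by positivity)
      (fun j => Finset.measurable_sum _ fun i _ => measurable_norm_sq _) _
      (summable_const_div_sq (K ^ 2 * ‖f‖ ^ 2)) fun j => ?_
    rw [lintegral_ofReal_sum _ _ (fun i x => sq_nonneg _) fun i => measurable_norm_sq _]
    simp_rw [lintegral_ofReal_norm_sq]
    rw [← ENNReal.ofReal_sum_of_nonneg fun i _ => sq_nonneg _]
    refine ENNReal.ofReal_le_ofReal ?_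
    rcases Nat.eq_zero_or_pos j with rfl | hj
    · simp
    have hj0 : (0 : ℝ) < j := by exact_mod_cast hj
    calc _ ≤ ∑ i ∈ Finset.range (j ^ 2), (K / (j : ℝ) ^ 2 * ‖f‖) ^ 2 :=
          Finset.sum_le_sum fun i _ => pow_le_pow_left₀ (norm_nonneg _)
            (hop j _ hj (le_gridPoint j i) (min_le_right _ _)) 2
      _ = _ := by
          rw [Finset.sum_const, Finset.card_range, nsmul_eq_mul]
          push_cast
          field_simp
  have hsubae : ∀ᵐ x ∂μ, ∀ j i : ℕ, (cfc (hilbertSymbol b (gridPoint j i)) V.1 f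
        - cfc (hilbertSymbol b (2 ^ j)) V.1 f : Lp ℂ 2 μ) x
      = cfc (hilbertSymbol b (gridPoint j i)) V.1 f x
        - cfc (hilbertSymbol b (2 ^ j)) V.1 f x :=
    ae_all_iff.2 fun j => ae_all_iff.2 fun i => Lp.coeFn_sub _ _
  have hcoe : ∀ᵐ x ∂μ, ∀ n : ℕ, cfc (hilbertSymbol b n) V.1 f x
      = modulatedSum b T.toEquiv f n x := ae_all_iff.2 fun n => by
    filter_upwards [coeFn_cfc_hilbertSymbol hT norm_one b n f] with x hx
    exact hx.trans (by simp)
  filter_upwards [hcoe, hdy, hgrid, hsubae,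
    ae_tendsto_dyadic_sum_norm_sq hT f] with x hcoe ⟨l, hl⟩ hg hs hfill
  refine ⟨l, ?_⟩
  simp only [hs, hcoe] at hl hg
  have hosc := (hg.const_mul 2).add (hfill.const_mul (4 * B ^ 2))
  simp only [mul_zero, add_zero] at hosc
  have hosc' := (Real.continuous_sqrt.tendsto 0).comp hosc
  rw [Real.sqrt_zero] at hosc'
  have hlog : Tendsto (fun n : ℕ => Nat.log 2 n) atTop atTop :=
    tendsto_atTop.2 fun j => eventually_atTop.2
      ⟨2 ^ j, fun n hn => Nat.le_log_of_pow_le one_lt_two hn⟩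
  have hl' : Tendsto (fun j => modulatedSum b T.toEquiv f (2 ^ j) x) atTop (𝓝 l) :=
    (tendsto_add_atTop_iff_nat 1).1 hl
  have hzero : Tendsto (fun n => modulatedSum b T.toEquiv f n x
      - modulatedSum b T.toEquiv f (2 ^ Nat.log 2 n) x) atTop (𝓝 0) := by
    refine squeeze_zero_norm' ?_ (hosc'.comp hlog)
    filter_upwards [eventually_ge_atTop 2] with n hn
    exact Real.le_sqrt_of_sq_le (norm_modulatedSum_sub_dyadic_sq_le b hB f
      (Nat.le_log_of_pow_le one_lt_two hn) (Nat.pow_log_le_self 2 (by omega))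
      (Nat.lt_pow_succ_log_self one_lt_two n) x)
  have := hzero.add (hl'.comp hlog)
  simpa [Function.comp_def] using this

end

/-! ### Sums of a weight with small exponential sums and a trigonometric polynomial -/

theorem modulatedSum_add {X : Type*} (a b : ℤ → ℂ) (T : Equiv.Perm X) (f : X → ℂ) (n : ℕ)
    (x : X) : modulatedSum (a + b) T f n x = modulatedSum a T f n x + modulatedSum b T f n x := by
  simp [modulatedSum, add_mul, add_div, Finset.sum_add_distrib]

theorem modulatedSum_smul {X : Type*} (c : ℂ) (b : ℤ → ℂ) (T : Equiv.Perm X) (f : X → ℂ) (n : ℕ)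
    (x : X) : modulatedSum (c • b) T f n x = c * modulatedSum b T f n x := by
  simp [modulatedSum, mul_assoc, mul_div_assoc, Finset.mul_sum]

theorem exists_norm_le_of_mem_classW {w : ℤ → ℂ} (hw : w ∈ ClassW) : ∃ B, ∀ k, ‖w k‖ ≤ B := by
  induction hw using Submodule.span_induction with
  | mem w hw =>
    obtain ⟨ξ, hξ, rfl⟩ := hw
    exact ⟨1, fun k => by rw [norm_zpow, hξ, one_zpow]⟩
  | zero => exact ⟨0, fun k => by simp⟩
  | add v w _ _ hv hw =>
    obtain ⟨B, hB⟩ := hv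
    obtain ⟨C, hC⟩ := hw
    exact ⟨B + C, fun k => (norm_add_le _ _).trans (add_le_add (hB k) (hC k))⟩
  | smul c w _ hw =>
    obtain ⟨B, hB⟩ := hw
    exact ⟨‖c‖ * B, fun k => by
      rw [Pi.smul_apply, norm_smul]
      exact mul_le_mul_of_nonneg_left (hB k) (norm_nonneg c)⟩

theorem ae_exists_tendsto_modulatedSum_of_mem_classW {X : Type u} [MeasurableSpace X]
    {μ : Measure X} {T : X ≃ᵐ X} (hT : MeasurePreserving T μ μ) {w : ℤ → ℂ} (hw : w ∈ ClassW)
    (f : Lp ℂ 2 μ) :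
    ∀ᵐ x ∂μ, ∃ l : ℂ, Tendsto (fun n => modulatedSum w T.toEquiv f n x) atTop (𝓝 l) := by
  induction hw using Submodule.span_induction with
  | mem w hw =>
    obtain ⟨ξ, hξ, rfl⟩ := hw
    exact ae_exists_tendsto_modulatedSum_character hT hξ f
  | zero => exact Eventually.of_forall fun x => ⟨0, by simp [modulatedSum]⟩
  | add v w _ _ hv hw =>
    filter_upwards [hv, hw] with x ⟨l, hl⟩ ⟨l', hl'⟩
    exact ⟨l + l', by simpa only [modulatedSum_add] using hl.add hl'⟩
  | smul c w _ hw =>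
    filter_upwards [hw] with x ⟨l, hl⟩
    exact ⟨c * l, by simpa only [modulatedSum_smul] using hl.const_mul c⟩

end ErgodicHilbert

end

theorem corollary2p4 (α : ℝ) (hα : 1 < α) (hα' : α ≤ 2) (a : ℤ → ℂ)
    (ha : a ∈ ErgodicHilbert.ClassAB α) :
    ErgodicHilbert.IsUniversallyGood.{u} a 2 := by
  intro X _ μ _ T hT f hf
  obtain ⟨hbdd, w, hw, hb⟩ := ha
  obtain ⟨A, hA⟩ := (memℓp_infty_iff.1 hbdd)
  obtain ⟨B, hB⟩ := ErgodicHilbert.exists_norm_le_of_mem_classW hw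
  obtain ⟨K, hK0, hK⟩ := ErgodicHilbert.norm_hilbertSymbol_sub_le_of_mem_classA hα' hb
  have hbB : ∀ k, ‖(a - w) k‖ ≤ A + B := fun k =>
    (norm_sub_le _ _).trans (add_le_add (hA ⟨k, rfl⟩) (hB k))
  have horbit : ∀ᵐ x ∂μ, ∀ k : ℤ,
      hf.toLp f ((T.toEquiv ^ k : Equiv.Perm X) x) = f ((T.toEquiv ^ k : Equiv.Perm X) x) :=
    ae_all_iff.2 fun k =>
      (ErgodicHilbert.measurePreserving_zpow hT k).quasiMeasurePreserving.ae hf.coeFn_toLp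
  filter_upwards [horbit,
    ErgodicHilbert.ae_exists_tendsto_modulatedSum_of_mem_classW hT hw (hf.toLp f),
    ErgodicHilbert.ae_exists_tendsto_modulatedSum_of_dyadic hT (a - w) hbB hK0 hK (hf.toLp f)]
    with x hx ⟨l, hl⟩ ⟨l', hl'⟩
  refine ⟨l' + l, (hl'.add hl).congr fun n => ?_⟩
  rw [← ErgodicHilbert.modulatedSum_add, sub_add_cancel]
  exact Finset.sum_congr rfl fun k _ => by rw [hx k]
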